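/- Let $A$ be a complete regular local ring of dimension $2$ with residue field $\kappa$, field of fractions $F$ and maximal ideal $\mathfrak m=(\pi_1,\pi_2)$. Let $L/F$ be a finite Galois extension whose degree is prime to $\operatorname{char}\kappa$, that is, $[L:F]$ is nonzero in $\kappa$ (no condition if $\operatorname{char}\kappa=0$). For a finite extension $E/F$ with $B$ the integral closure of $A$ in $E$, say that $E/F$ is unramified at a prime $\mathfrak p$ of $A$ if $B$ is unramified over $A$ at every prime of $B$ lying over $\mathfrak p$. Say that $E/F$ is unramified on $A$ if it is unramified at every prime of $A$, and unramified on $A$ except possibly at $\pi_1$ and $\pi_2$ if it is unramified at every prime of $A$ containing neither $\pi_1$ nor $\pi_2$ (that is, at the zero ideal and at all height-one primes other than $(\pi_1)$ and $(\pi_2)$). Suppose that $L/F$ is unramified on $A$ except possibly at $\pi_1$ and $\pi_2$. Then there exist subfields $F\subseteq L_1\subseteq L_2\subseteq L$, integers $d_1,d_2\ge 1$ and $i\ge 0$, and elements $\alpha,\beta\in L$ such that - $L_1/F$ is unramified on $A$; - $L_2=L_1(\alpha)$ with $\alpha^{d_1}=u\pi_1$ for some unit $u$ of the integral closure of $A$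 in $L_1$, i.e. $L_2=L_1(\sqrt[d_1]{u\pi_1})$; - $L=L_2(\beta)$ with $\beta^{d_2}=v\,\alpha^{i}\,\pi_2$ for some unit $v$ of the integral closure of $A$ in $L_2$, i.e. $L=L_2\big(\sqrt[d_2]{v(\sqrt[d_1]{u\pi_1})^{i}\pi_2}\big)$. -/

import Mathlib

/-- For a domain `A` with fraction field `F` and a finite field extension `L/F`: the extension
`L/F` is unramified at the prime `p` of `A` if the integral closure `B` of `A` in `L` is
unramified over `A` at every prime `q` of `B` lying over `p`. (When `B` is finite over `A`, this
says that `p B_q = q B_q` and that `κ(q)/κ(p)` is a separable extension.) -/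
def UnramifiedAtPrime (A L : Type*) [CommRing A] [Field L] [Algebra A L] (p : Ideal A) : Prop :=
  ∀ (q : Ideal (integralClosure A L)) [q.IsPrime], q.LiesOver p → Algebra.IsUnramifiedAt A q

/-- `L/F` is unramified on `A` except possibly at the elements of `S`: it is unramified at every
prime of `A` outside the union of the closed subsets `V(x)` of `Spec A`, for `x ∈ S`. -/
def UnramifiedExceptAt (A L : Type*) [CommRing A] [Field L] [Algebra A L] (S : Set A) : Prop :=
  ∀ (p : Ideal A) [p.IsPrime], (∀ x ∈ S, x ∉ p) → UnramifiedAtPrime A L p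

/-- `L/F` is unramified on `A`: it is unramified at every prime of `A`. -/
def UnramifiedOn (A L : Type*) [CommRing A] [Field L] [Algebra A L] : Prop :=
  UnramifiedExceptAt A L ∅

/-!
Let `B` be the integral closure of `A` in `L` and `n = [L : F]`, which is a unit in `A`. Since `A`
is complete, `B` is a complete local ring, and units of `B` congruent to `1` modulo its maximal
ideal have `d`-th roots for every `d` dividing `n`.

The field `L₁` is the fixed field of the inertia group of `B`. It is generated by an integral
element whose conjugates differ by units, so it is unramified on `A`
(`unramifiedOn_adjoin_of_forall_isIntegralUnit_sub`), and it has the same residue field as `L`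
(`exists_generator_inertia_field`). By the statement on roots of units, each unit of `B` is the
product of a unit in `L₁` and a `d`-th power (`IsIntegralUnit.exists_eq_mul_pow`).

The ramified part `L / L₁` is handled without purity of the branch locus or Abhyankar's lemma, by
means of the lattices `J(a, b)` of all `z` in `L` with `z ^ n * π₁ ^ (-a) * π₂ ^ (-b)` integral
(`powLattice`); they prescribe lower bounds `a / n` and `b / n` for the valuations above `π₁` and
`π₂`. Each of these lattices is a free `A`-module (`free_powLattice`), since `A` is regular of
dimension two. Tameness at `π₁` and `π₂` and unramifiedness at the other primes give an upper bound
for the trace dual of `J(-a, -b)` (`mem_powLattice_of_forall_trace`). Now let `z` be in `J(a, b)`.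
If the trace takes `z * J(-a, -b)` into the maximal ideal `(π₁, π₂)`, freeness allows `z` to be
written as `π₁ * w₁ + π₂ * w₂` with `w₁` and `w₂` in that dual, and then `z` belongs to
`J(a + 1, b) + J(a, b + 1)`. Otherwise some product `z * t` with `t` in `J(-a, -b)` has a unit as
its trace, so it is a unit of the local ring `B`, and `z ^ n` equals `π₁ ^ a * π₂ ^ b` up to a unit
(`mem_sup_or_hasExponents`).

The pairs `(a, b)` which occur in the second case form a subgroup of `ℤ × ℤ` containing `(n, 0)`
and `(0, n)`. A triangular basis `(a₁, 0)`, `(c, b₂)` of it (`exists_triangular_basis`) provides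
`α` and `β`, after correction by units so that the units in their equations lie in `L₁`. The field
`L₁(α, β)` contains elements for all pairs that occur and has the residue field of `L`. Therefore
successive approximation along the lattices, which ends after finitely many steps modulo the
maximal ideal of `A`, and Nakayama's lemma show that it contains `B`
(`eq_top_of_forall_hasExponents`).
-/

/-! ### Regular local rings of dimension two -/

/-- A Noetherian local ring whose maximal ideal is generated by a non-nilpotent element `t` is a
discrete valuation ring: by Krull's intersection theorem each nonzero element is a unit times a
power of `t`. -/
theorem isDomain_and_isPrincipalIdealRing_of_maximalIdeal_eq_span
    {Q : Type*} [CommRing Q] [IsLocalRing Q] [IsNoetherianRing Q] {t : Q}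
    (ht : IsLocalRing.maximalIdeal Q = Ideal.span {t}) (hnil : ¬ IsNilpotent t) :
    IsDomain Q ∧ IsPrincipalIdealRing Q := by
  have key : ∀ x : Q, x ≠ 0 → ∃ (k : ℕ) (u : Q), IsUnit u ∧ x = u * t ^ k := by
    intro x hx
    have hkrull : (⨅ i : ℕ, IsLocalRing.maximalIdeal Q ^ i) = ⊥ :=
      Ideal.iInf_pow_eq_bot_of_isLocalRing _ (Ideal.IsPrime.ne_top inferInstance)
    have hex : ∃ k : ℕ, x ∉ IsLocalRing.maximalIdeal Q ^ k := by
      by_contra! h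
      exact hx (by simpa [hkrull] using (Ideal.mem_iInf (I := fun i : ℕ ↦
        IsLocalRing.maximalIdeal Q ^ i)).mpr h)
    classical
    obtain ⟨k, hk⟩ : ∃ k, Nat.find hex = k + 1 := by
      refine Nat.exists_eq_succ_of_ne_zero fun h0 ↦ ?_
      have := Nat.find_spec hex
      simp [h0] at this
    have h1 : x ∈ IsLocalRing.maximalIdeal Q ^ k := by
      by_contra h
      have := Nat.find_min' hex h
      omega
    have h2 : x ∉ IsLocalRing.maximalIdeal Q ^ (k + 1) := hk ▸ Nat.find_spec hex
    rw [ht, Ideal.span_singleton_pow, Ideal.mem_span_singleton] at h1 h2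
    obtain ⟨u, hu⟩ := h1
    refine ⟨k, u, ?_, by rw [hu, mul_comm]⟩
    by_contra hnu
    have : u ∈ IsLocalRing.maximalIdeal Q := hnu
    rw [ht, Ideal.mem_span_singleton] at this
    obtain ⟨v, rfl⟩ := this
    exact h2 ⟨v, by rw [hu, pow_succ]; ring⟩
  have hpow : ∀ k : ℕ, t ^ k ≠ 0 := fun k hk ↦ hnil ⟨k, hk⟩
  have hdom : IsDomain Q := by
    have : NoZeroDivisors Q := by
      refine ⟨fun {x y} hxy ↦ ?_⟩
      by_contra! h
      obtain ⟨k, u, hu, rfl⟩ := key x h.1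
      obtain ⟨l, v, hv, rfl⟩ := key y h.2
      refine hpow (k + l) ((hu.mul hv).mul_right_eq_zero.mp ?_)
      rw [← hxy]; ring
    exact NoZeroDivisors.to_isDomain Q
  refine ⟨hdom, ?_⟩
  have hP : (IsLocalRing.maximalIdeal Q).IsPrincipal := ⟨t, ht⟩
  exact ((tfae_of_isNoetherianRing_of_isLocalRing_of_isDomain (R := Q)).out 4 0).mp hP

section RegularDimTwo

variable {A : Type*} [CommRing A] [IsLocalRing A] [IsNoetherianRing A]

/-- By Krull's height theorem the maximal ideal is not minimal over `π₁`, hence `π₂` is not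
nilpotent modulo `π₁`. -/
theorem pow_notMem_span_of_ringKrullDim_eq_two (hdim : ringKrullDim A = 2) {π₁ π₂ : A}
    (hmax : IsLocalRing.maximalIdeal A = Ideal.span {π₁, π₂}) (k : ℕ) :
    π₂ ^ k ∉ Ideal.span {π₁} := by
  intro hk
  have hmin : IsLocalRing.maximalIdeal A ∈ (Ideal.span {π₁}).minimalPrimes := by
    refine ⟨⟨inferInstance, ?_⟩, fun p hp hle ↦ ?_⟩
    · rw [hmax]; exact Ideal.span_mono (by simp)
    · have : p.IsPrime := hp.1
      rw [hmax, Ideal.span_le]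
      rintro x (rfl | rfl)
      · exact hp.2 (Ideal.mem_span_singleton_self _)
      · exact this.mem_of_pow_mem k (hp.2 hk)
  have h1 := Ideal.height_le_one_of_isPrincipal_of_mem_minimalPrimes _ _ hmin
  have h2 := IsLocalRing.maximalIdeal_height_eq_ringKrullDim (R := A)
  rw [hdim] at h2
  have h3 : (IsLocalRing.maximalIdeal A).height = 2 := WithBot.coe_inj.mp h2
  rw [h3] at h1
  exact absurd h1 (by decide)

theorem isDomain_and_isPrincipalIdealRing_quotient (hdim : ringKrullDim A = 2) {π₁ π₂ : A}
    (hmax : IsLocalRing.maximalIdeal A = Ideal.span {π₁, π₂}) :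
    IsDomain (A ⧸ Ideal.span {π₁}) ∧ IsPrincipalIdealRing (A ⧸ Ideal.span {π₁}) := by
  have hle : Ideal.span {π₁} ≤ IsLocalRing.maximalIdeal A := by
    rw [hmax]; exact Ideal.span_mono (by simp)
  have hne : Ideal.span {π₁} ≠ ⊤ := fun h ↦
    (Ideal.IsPrime.ne_top (inferInstance : (IsLocalRing.maximalIdeal A).IsPrime))
      (top_le_iff.mp (h ▸ hle))
  have : Nontrivial (A ⧸ Ideal.span {π₁}) := Ideal.Quotient.nontrivial_iff.mpr hne
  have : IsLocalRing (A ⧸ Ideal.span {π₁}) :=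
    IsLocalRing.of_surjective' _ Ideal.Quotient.mk_surjective
  refine isDomain_and_isPrincipalIdealRing_of_maximalIdeal_eq_span
    (t := Ideal.Quotient.mk _ π₂) ?_ ?_
  · have h := IsLocalRing.map_maximalIdeal_of_surjective
      (Ideal.Quotient.mk (Ideal.span {π₁})) Ideal.Quotient.mk_surjective
    rw [← h, hmax, Ideal.map_span, Set.image_pair, Ideal.Quotient.eq_zero_iff_mem.mpr
      (Ideal.mem_span_singleton_self π₁), Ideal.span_insert_zero]
  · rintro ⟨k, hk⟩
    rw [← map_pow, Ideal.Quotient.eq_zero_iff_mem] at hk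
    exact pow_notMem_span_of_ringKrullDim_eq_two hdim hmax k hk

theorem prime_of_maximalIdeal_eq_span (hdim : ringKrullDim A = 2) {π₁ π₂ : A}
    (hmax : IsLocalRing.maximalIdeal A = Ideal.span {π₁, π₂}) : Prime π₁ := by
  have h0 : π₁ ≠ 0 := by
    rintro rfl
    have h : IsLocalRing.maximalIdeal A = Ideal.span {π₂, 0} := by rw [hmax, Set.pair_comm]
    exact pow_notMem_span_of_ringKrullDim_eq_two hdim h 1 (by simp)
  rw [← Ideal.span_singleton_prime h0, ← Ideal.Quotient.isDomain_iff_prime]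
  exact (isDomain_and_isPrincipalIdealRing_quotient hdim hmax).1

/-- Prime ideals avoiding `π₁` are principal, because their images in the discrete valuation ring
`A / π₁` are; Kaplansky's criterion applies. -/
theorem uniqueFactorizationMonoid_of_ringKrullDim_eq_two [IsDomain A]
    (hdim : ringKrullDim A = 2) {π₁ π₂ : A}
    (hmax : IsLocalRing.maximalIdeal A = Ideal.span {π₁, π₂}) : UniqueFactorizationMonoid A := by
  have hprime := prime_of_maximalIdeal_eq_span hdim hmax
  have hpid := (isDomain_and_isPrincipalIdealRing_quotient hdim hmax).2
  rw [UniqueFactorizationMonoid.iff_exists_prime_mem_of_isPrime]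
  intro P hP0 hP
  by_cases h1 : π₁ ∈ P
  · exact ⟨π₁, h1, hprime⟩
  obtain ⟨g', hg'⟩ := (hpid.principal (P.map (Ideal.Quotient.mk (Ideal.span {π₁})))).principal
  have hg'mem : g' ∈ P.map (Ideal.Quotient.mk (Ideal.span {π₁})) := by
    rw [hg']; exact Submodule.mem_span_singleton_self _
  obtain ⟨g, hgP, rfl⟩ :=
    (Ideal.mem_map_iff_of_surjective _ Ideal.Quotient.mk_surjective).mp hg'mem
  -- If `x - c * g = π₁ * y` with `x`, `g` in `P`, then `y` is in `P` because `π₁` is not.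
  have hle : P ≤ Ideal.span {g} ⊔ Ideal.span {π₁} • P := by
    intro x hx
    have hx' : Ideal.Quotient.mk (Ideal.span {π₁}) x ∈
        P.map (Ideal.Quotient.mk (Ideal.span {π₁})) := Ideal.mem_map_of_mem _ hx
    rw [hg'] at hx'
    obtain ⟨c', hc'⟩ := Submodule.mem_span_singleton.mp hx'
    obtain ⟨c, rfl⟩ := Ideal.Quotient.mk_surjective c'
    rw [smul_eq_mul, ← map_mul, Ideal.Quotient.eq, Ideal.mem_span_singleton] at hc'
    obtain ⟨y, hy⟩ := hc'
    have hyP : y ∈ P := by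
      refine (hP.mem_or_mem (x := π₁) ?_).resolve_left h1
      rw [← hy]
      exact P.sub_mem (P.mul_mem_left _ hgP) hx
    have hx2 : x = c * g + π₁ * (-y) := by linear_combination -hy
    rw [hx2]
    exact Submodule.add_mem_sup (Ideal.mem_span_singleton.mpr (dvd_mul_left _ _))
      (Submodule.smul_mem_smul (Ideal.mem_span_singleton_self _) (P.neg_mem hyP))
  have hjac : Ideal.span {π₁} ≤ Ideal.jacobson ⊥ := by
    rw [IsLocalRing.jacobson_eq_maximalIdeal ⊥ bot_ne_top, hmax]
    exact Ideal.span_mono (by simp)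
  have hP2 : P = Ideal.span {g} := le_antisymm
    (Submodule.le_of_le_smul_of_le_jacobson_bot (IsNoetherian.noetherian P) hjac hle)
    ((Ideal.span_singleton_le_iff_mem _).mpr hgP)
  have hg0 : g ≠ 0 := by
    rintro rfl
    exact hP0 (by simpa using hP2)
  exact ⟨g, hgP, (Ideal.span_singleton_prime hg0).mp (hP2 ▸ hP)⟩

end RegularDimTwo

/-- An element of the fraction field of a factorial domain belongs to the domain if it is
integral at all principal primes `(ϖ)`. -/
theorem mem_range_algebraMap_of_forall_prime {A F : Type*} [CommRing A] [IsDomain A]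
    [UniqueFactorizationMonoid A] [Field F] [Algebra A F] [IsFractionRing A F] (x : F)
    (h : ∀ ϖ : A, Prime ϖ → ∃ s : A, ¬ ϖ ∣ s ∧ algebraMap A F s * x ∈ (algebraMap A F).range) :
    x ∈ (algebraMap A F).range := by
  obtain ⟨a, b, hab, rfl⟩ := IsFractionRing.exists_reduced_fraction (A := A) x
  by_cases hb : IsUnit (b : A)
  · obtain ⟨u, hu⟩ := hb
    refine ⟨a * (↑u⁻¹ : A), ?_⟩
    rw [IsFractionRing.mk'_eq_div, ← hu, eq_div_iff, ← map_mul, Units.inv_mul_cancel_right]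
    simp
  · obtain ⟨ϖ, hϖ, hdvd⟩ :=
      WfDvdMonoid.exists_irreducible_factor hb (nonZeroDivisors.coe_ne_zero b)
    have hp := hϖ.prime
    obtain ⟨s, hs, c, hc⟩ := h ϖ hp
    rw [IsFractionRing.mk'_eq_div] at hc
    have hb0 : algebraMap A F b ≠ 0 := by
      simp [nonZeroDivisors.coe_ne_zero b]
    rw [mul_div_assoc', eq_div_iff hb0, ← map_mul, ← map_mul] at hc
    have hc' := IsFractionRing.injective A F hc
    have : ϖ ∣ s * a := hc' ▸ hdvd.mul_left c
    exact absurd (hab ((hp.dvd_or_dvd this).resolve_left hs) hdvd) hϖ.not_isUnit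

/-! ### Freeness over regular local rings of dimension two -/

/-- A finitely generated module `M` over a Noetherian local ring `A` is free if `π` is a
nonzerodivisor on `M`, the ring `A / π` is a principal ideal domain and `M / π M` is torsion free
over it: a basis of `M / π M` lifts to one of `M`. -/
theorem free_of_torsionFree_quotient {A M : Type*} [CommRing A] [IsLocalRing A]
    [IsNoetherianRing A] [AddCommGroup M] [Module A M] [Module.Finite A M] {π : A}
    (hπ : π ∈ IsLocalRing.maximalIdeal A) [IsDomain (A ⧸ Ideal.span {π})]
    [IsPrincipalIdealRing (A ⧸ Ideal.span {π})]
    (h1 : ∀ x : M, π • x = 0 → x = 0)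
    (h2 : ∀ (c : A) (x y : M), ¬ π ∣ c → c • x = π • y → ∃ y', x = π • y') :
    Module.Free A M := by
  let I := Ideal.span {π}
  let N := M ⧸ (I • ⊤ : Submodule A M)
  have hmem : ∀ x : M, x ∈ (I • ⊤ : Submodule A M) ↔ ∃ y, x = π • y := by
    intro x
    rw [Submodule.ideal_span_singleton_smul, Submodule.mem_smul_pointwise_iff_exists]
    simp [eq_comm]
  have : Module.IsTorsionFree (A ⧸ I) N := by
    refine Module.IsTorsionFree.of_smul_eq_zero ?_
    intro c x hcx
    obtain ⟨c, rfl⟩ := Ideal.Quotient.mk_surjective c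
    obtain ⟨x, rfl⟩ := Submodule.Quotient.mk_surjective _ x
    by_cases hc : π ∣ c
    · left; exact Ideal.Quotient.eq_zero_iff_mem.mpr (Ideal.mem_span_singleton.mpr hc)
    · right
      change Submodule.Quotient.mk (c • x) = 0 at hcx
      rw [Submodule.Quotient.mk_eq_zero, hmem] at hcx
      obtain ⟨y, hy⟩ := hcx
      rw [Submodule.Quotient.mk_eq_zero, hmem]
      exact h2 c x y hc hy
  have : Module.Finite (A ⧸ I) N := Module.Finite.of_restrictScalars_finite A _ _
  have : Module.Free (A ⧸ I) N := inferInstance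
  let b := Module.Free.chooseBasis (A ⧸ I) N
  choose v hv using fun i ↦ Submodule.Quotient.mk_surjective (I • ⊤ : Submodule A M) (b i)
  have hsum : ∀ (g : Module.Free.ChooseBasisIndex (A ⧸ I) N → A),
      (Submodule.Quotient.mk (∑ i, g i • v i) : N) = ∑ i, Ideal.Quotient.mk I (g i) • b i := by
    intro g
    rw [← Submodule.mkQ_apply, map_sum]
    refine Finset.sum_congr rfl fun i _ ↦ ?_
    rw [← hv]; rfl
  have hli : LinearIndependent A v := by
    rw [Fintype.linearIndependent_iff]
    intro g hg i
    -- The coefficients of a linear relation are divisible by `π`, and dividing by `π` gives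
    -- another relation; so they lie in all powers of `(π)`.
    have key : ∀ (k : ℕ) (g : Module.Free.ChooseBasisIndex (A ⧸ I) N → A),
        ∑ i, g i • v i = 0 → ∀ i, g i ∈ I ^ k := by
      intro k
      induction k with
      | zero => simp
      | succ k ih =>
        intro g hg i
        have h0 : ∑ i, Ideal.Quotient.mk I (g i) • b i = 0 := by rw [← hsum, hg]; rfl
        have h3 := Fintype.linearIndependent_iff.mp b.linearIndependent _ h0
        have h4 : ∀ i, ∃ c, g i = π * c := fun i ↦
          Ideal.mem_span_singleton.mp (Ideal.Quotient.eq_zero_iff_mem.mp (h3 i))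
        choose g' hg' using h4
        have h5 : ∑ i, g' i • v i = 0 := by
          apply h1
          rw [Finset.smul_sum, ← hg]
          exact Finset.sum_congr rfl fun i _ ↦ by rw [hg', mul_smul]
        rw [hg', pow_succ']
        exact Ideal.mul_mem_mul (Ideal.mem_span_singleton_self _) (ih g' h5 i)
    have hkrull : (⨅ k : ℕ, I ^ k) = ⊥ := by
      refine Ideal.iInf_pow_eq_bot_of_isLocalRing _ fun h ↦ ?_
      exact Ideal.IsPrime.ne_top (inferInstance : (IsLocalRing.maximalIdeal A).IsPrime)
        (top_le_iff.mp (h ▸ (Ideal.span_singleton_le_iff_mem _).mpr hπ))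
    have : g i ∈ (⨅ k : ℕ, I ^ k) := (Ideal.mem_iInf).mpr fun k ↦ key k g hg i
    simpa [hkrull] using this
  have hspan : ⊤ ≤ Submodule.span A (Set.range v) := by
    refine Submodule.le_of_le_smul_of_le_jacobson_bot (I := I) Module.Finite.fg_top ?_ ?_
    · rw [IsLocalRing.jacobson_eq_maximalIdeal ⊥ bot_ne_top]
      exact (Ideal.span_singleton_le_iff_mem _).mpr hπ
    · intro x _
      choose g hg using fun i ↦ Ideal.Quotient.mk_surjective (b.repr (Submodule.Quotient.mk x) i)
      have h6 : (Submodule.Quotient.mk (∑ i, g i • v i) : N) = Submodule.Quotient.mk x := by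
        rw [hsum]; simp_rw [hg]; exact b.sum_repr _
      rw [Submodule.Quotient.eq] at h6
      rw [← sub_sub_cancel (∑ i, g i • v i) x]
      exact Submodule.sub_mem _ (Submodule.mem_sup_left (Submodule.sum_mem _ fun i _ ↦
        Submodule.smul_mem _ _ (Submodule.subset_span ⟨i, rfl⟩))) (Submodule.mem_sup_right h6)
  exact Module.Free.of_basis (Module.Basis.mk hli hspan)

/-- A functional on a finite free module with values in `(x, y)` is a combination of `x` and `y`
with functionals as coefficients. -/
theorem exists_eq_smul_add_smul_of_free {A M : Type*} [CommRing A] [AddCommGroup M] [Module A M]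
    [Module.Free A M] {x y : A} (f : M →ₗ[A] A)
    (hf : ∀ m, f m ∈ Ideal.span {x, y}) : ∃ g h : M →ₗ[A] A, f = x • g + y • h := by
  let b := Module.Free.chooseBasis A M
  choose c d hcd using fun i ↦ Ideal.mem_span_pair.mp (hf (b i))
  refine ⟨b.constr A c, b.constr A d, b.ext fun i ↦ ?_⟩
  simp [← hcd, mul_comm]

/-! ### Lattices defined by integrality conditions -/

section PowLattice

variable {A L : Type*} [CommRing A] [Field L] [Algebra A L] (n : ℕ) [NeZero n]

theorem IsIntegral.pow_mul_pow_mul {z w x : L} (hz : IsIntegral A (z ^ n * x))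
    (hw : IsIntegral A (w ^ n * x)) {k l : ℕ} (h : k + l = n) :
    IsIntegral A (z ^ k * w ^ l * x) := by
  -- The `n`-th power of this element is a product of powers of the two given ones.
  refine IsIntegral.of_pow (NeZero.pos n) ?_
  have : (z ^ k * w ^ l * x) ^ n = (z ^ n * x) ^ k * (w ^ n * x) ^ l := by
    rw [mul_pow _ x n, ← h]; ring
  rw [this]
  exact (hz.pow k).mul (hw.pow l)

variable (A) in
/-- The `A`-submodule of all `z ∈ L` such that `z ^ n * x` is integral over `A`. When `A` is normal
and `x` is a product of powers of prime elements, it consists of the `z` with prescribed lower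
bounds (with denominator `n`) for the valuations above these primes and with nonnegative valuation
elsewhere. -/
def powLattice (x : L) : Submodule A L where
  carrier := {z | IsIntegral A (z ^ n * x)}
  zero_mem' := by simp [NeZero.ne n, isIntegral_zero]
  add_mem' {z w} hz hw := by
    change IsIntegral A ((z + w) ^ n * x)
    rw [add_pow, Finset.sum_mul]
    refine IsIntegral.sum _ fun k hk ↦ ?_
    have h : k + (n - k) = n := by rw [Finset.mem_range] at hk; omega
    have h2 : z ^ k * w ^ (n - k) * (n.choose k : L) * x =
        (n.choose k) • (z ^ k * w ^ (n - k) * x) := by rw [nsmul_eq_mul]; ring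
    rw [h2]
    exact (IsIntegral.pow_mul_pow_mul n hz hw h).smul _
  smul_mem' a z hz := by
    change IsIntegral A ((a • z) ^ n * x)
    rw [smul_pow, smul_mul_assoc]
    exact IsIntegral.smul _ hz

variable {n}

theorem mem_powLattice {x z : L} : z ∈ powLattice A n x ↔ IsIntegral A (z ^ n * x) := Iff.rfl

theorem mem_powLattice_one {z : L} : z ∈ powLattice A n (1 : L) ↔ IsIntegral A z := by
  rw [mem_powLattice, mul_one]
  exact ⟨IsIntegral.of_pow (NeZero.pos n), fun h ↦ h.pow n⟩

theorem mul_mem_powLattice {x y z w : L} (hz : z ∈ powLattice A n x) (hw : w ∈ powLattice A n y) :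
    z * w ∈ powLattice A n (x * y) := by
  rw [mem_powLattice, mul_pow, mul_mul_mul_comm]
  exact IsIntegral.mul hz hw

theorem IsIntegral.mul_mem_powLattice {x z b : L} (hb : IsIntegral A b)
    (hz : z ∈ powLattice A n x) : b * z ∈ powLattice A n x := by
  have := _root_.mul_mem_powLattice (mem_powLattice_one (n := n).mpr hb) hz
  rwa [one_mul] at this

theorem isIntegral_of_isIntegral_smul_pow {s : A} {z x : L} (h : IsIntegral A (s • (z ^ n * x))) :
    s • z ∈ powLattice A n x := by
  rw [mem_powLattice, smul_pow, smul_mul_assoc]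
  obtain ⟨k, hk⟩ := Nat.exists_eq_succ_of_ne_zero (NeZero.ne n)
  rw [hk, pow_succ, mul_smul, ← hk]
  exact h.smul _

theorem exists_smul_mem_powLattice [Algebra.IsAlgebraic A L] (x z : L) :
    ∃ s : A, s ≠ 0 ∧ s • z ∈ powLattice A n x := by
  obtain ⟨s, hs, h⟩ :=
    (Algebra.IsAlgebraic.isAlgebraic (R := A) (z ^ n * x)).exists_integral_multiple
  exact ⟨s, hs, isIntegral_of_isIntegral_smul_pow h⟩

theorem finite_powLattice [IsDomain A] [FaithfulSMul A L] [IsNoetherianRing A]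
    [Algebra.IsAlgebraic A L]
    [Module.Finite A (integralClosure A L)] {x : L} (hx : x ≠ 0) :
    Module.Finite A (powLattice A n x) := by
  obtain ⟨s, hs, h⟩ :=
    (Algebra.IsAlgebraic.isAlgebraic (R := A) x⁻¹).exists_integral_multiple
  let f : powLattice A n x →ₗ[A] integralClosure A L :=
    { toFun := fun z ↦ ⟨s • (z : L), by
        have h1 : IsIntegral A (s • ((z : L) ^ n * 1)) := by
          have h2 : s • ((z : L) ^ n * 1) = (z ^ n * x) * (s • x⁻¹) := by
            rw [mul_smul_comm, mul_assoc, mul_inv_cancel₀ hx]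
          rw [h2]
          exact (mem_powLattice.mp z.2).mul h
        exact mem_powLattice_one.mp (isIntegral_of_isIntegral_smul_pow h1)⟩
      map_add' := fun z w ↦ Subtype.ext (by simp)
      map_smul' := fun c z ↦ Subtype.ext (by simp [smul_comm s c]) }
  refine Module.Finite.of_injective f fun z w hzw ↦ ?_
  have h3 : s • (z : L) = s • (w : L) := congrArg Subtype.val hzw
  have hs' : algebraMap A L s ≠ 0 := by simpa using hs
  rw [Algebra.smul_def, Algebra.smul_def] at h3
  exact Subtype.ext (mul_left_cancel₀ hs' h3)

end PowLattice

/-- Over a factorial domain, integrality may be checked locally at the principal primes. -/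
theorem isIntegral_of_forall_prime {A L : Type*} (F : Type*) [CommRing A] [IsDomain A]
    [UniqueFactorizationMonoid A] [Field F] [Algebra A F] [IsFractionRing A F]
    [Field L] [Algebra F L] [Algebra A L] [IsScalarTower A F L] [Algebra.IsAlgebraic F L] (z : L)
    (h : ∀ ϖ : A, Prime ϖ → ∃ s : A, ¬ ϖ ∣ s ∧ IsIntegral A (s • z)) : IsIntegral A z := by
  have hc : ∀ i, (minpoly F z).coeff i ∈ (algebraMap A F).range := by
    intro i
    refine mem_range_algebraMap_of_forall_prime _ fun ϖ hϖ ↦ ?_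
    obtain ⟨s, hs, hint⟩ := h ϖ hϖ
    refine ⟨s ^ ((minpoly F z).natDegree - i), fun h ↦ hs (hϖ.dvd_of_dvd_pow h), ?_⟩
    have h1 := minpoly.isIntegrallyClosed_eq_field_fractions' F hint
    rw [← algebraMap_smul F s z, IsIntegrallyClosed.minpoly_smul (by
      rintro h0
      exact hs (by simp [(IsFractionRing.injective A F) (h0.trans (map_zero _).symm)]))
      (Algebra.IsIntegral.isIntegral z)] at h1
    have h2 := congrArg (fun p ↦ p.coeff i) h1
    simp only [Polynomial.coeff_scaleRoots, Polynomial.coeff_map] at h2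
    exact ⟨_, by rw [← h2, map_pow, mul_comm]⟩
  have h1 : minpoly F z ∈ Polynomial.lifts (algebraMap A F) := by
    rw [Polynomial.lifts_iff_coeff_lifts]
    exact hc
  obtain ⟨p, hp, -, hmon⟩ := Polynomial.lifts_and_natDegree_eq_and_monic h1
    (minpoly.monic (Algebra.IsIntegral.isIntegral (R := F) z))
  refine ⟨p, hmon, ?_⟩
  have := minpoly.aeval F z
  rwa [← hp, Polynomial.aeval_map_algebraMap] at this

/-! ### Units of the integral closure and tame trace duality over a discrete valuation ring -/

section IntegralUnit

variable {A L : Type*} [CommRing A] [Field L] [Algebra A L]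

variable (A) in
/-- The element `z` of the field `L` is a unit of the integral closure of `A` in `L`. -/
def IsIntegralUnit (z : L) : Prop := z ≠ 0 ∧ IsIntegral A z ∧ IsIntegral A z⁻¹

namespace IsIntegralUnit

theorem one : IsIntegralUnit A (1 : L) :=
  ⟨one_ne_zero, isIntegral_one, by simpa using isIntegral_one⟩

theorem mul {z w : L} (hz : IsIntegralUnit A z) (hw : IsIntegralUnit A w) :
    IsIntegralUnit A (z * w) :=
  ⟨mul_ne_zero hz.1 hw.1, hz.2.1.mul hw.2.1, by rw [mul_inv]; exact hz.2.2.mul hw.2.2⟩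

theorem inv {z : L} (hz : IsIntegralUnit A z) : IsIntegralUnit A z⁻¹ :=
  ⟨inv_ne_zero hz.1, hz.2.2, by rw [inv_inv]; exact hz.2.1⟩

theorem pow {z : L} (hz : IsIntegralUnit A z) (k : ℕ) : IsIntegralUnit A (z ^ k) :=
  ⟨pow_ne_zero _ hz.1, hz.2.1.pow k, by rw [← inv_pow]; exact hz.2.2.pow k⟩

theorem zpow {z : L} (hz : IsIntegralUnit A z) (k : ℤ) : IsIntegralUnit A (z ^ k) := by
  obtain ⟨k, rfl | rfl⟩ := k.eq_nat_or_neg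
  · simpa using hz.pow k
  · simpa using (hz.pow k).inv

theorem of_pow {z : L} {k : ℕ} (hk : k ≠ 0) (hz : IsIntegralUnit A (z ^ k)) :
    IsIntegralUnit A z :=
  ⟨fun h ↦ hz.1 (by simp [h, hk]), IsIntegral.of_pow (Nat.pos_of_ne_zero hk) hz.2.1,
    IsIntegral.of_pow (Nat.pos_of_ne_zero hk) (by rw [inv_pow]; exact hz.2.2)⟩

theorem of_isUnit {a : A} (ha : IsUnit a) : IsIntegralUnit A (algebraMap A L a) := by
  obtain ⟨u, rfl⟩ := ha
  have h : algebraMap A L (u : A) * algebraMap A L ((u⁻¹ : Aˣ) : A) = 1 := by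
    rw [← map_mul]; simp
  exact ⟨left_ne_zero_of_mul_eq_one h, isIntegral_algebraMap, by
    rw [inv_eq_of_mul_eq_one_right h]; exact isIntegral_algebraMap⟩

theorem prod {ι : Type*} (s : Finset ι) {f : ι → L} (h : ∀ i ∈ s, IsIntegralUnit A (f i)) :
    IsIntegralUnit A (∏ i ∈ s, f i) :=
  ⟨Finset.prod_ne_zero_iff.mpr fun i hi ↦ (h i hi).1, IsIntegral.prod _ fun i hi ↦ (h i hi).2.1, by
    rw [← Finset.prod_inv_distrib]; exact IsIntegral.prod _ fun i hi ↦ (h i hi).2.2⟩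

end IsIntegralUnit

theorem IsIntegral.algEquiv {F : Type*} [Field F] [Algebra A F] [Algebra F L] [IsScalarTower A F L]
    {z : L} (hz : IsIntegral A z) (σ : L ≃ₐ[F] L) : IsIntegral A (σ z) :=
  hz.map (σ.toAlgHom.restrictScalars A)

end IntegralUnit

section DVR

variable {R F L : Type*} [CommRing R] [IsDomain R] [IsDiscreteValuationRing R] [Field F]
  [Algebra R F] [IsFractionRing R F] [Field L] [Algebra F L] [Algebra R L] [IsScalarTower R F L]
  [FiniteDimensional F L] [IsGalois F L]

omit [IsGalois F L] in
/-- The integral closure is a Dedekind domain with finitely many maximal ideals. -/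
theorem isPrincipalIdealRing_integralClosure_of_isDiscreteValuationRing
    [Algebra.IsSeparable F L] : IsPrincipalIdealRing (integralClosure R L) := by
  have : IsDedekindDomain (integralClosure R L) := integralClosure.isDedekindDomain R F L
  have : FaithfulSMul R L := (faithfulSMul_iff_algebraMap_injective R L).mpr (by
    rw [IsScalarTower.algebraMap_eq R F L]
    exact (algebraMap F L).injective.comp (IsFractionRing.injective R F))
  have : Module.IsTorsionFree R L := inferInstance
  refine IsPrincipalIdealRing.of_finite_maximals ?_
  refine (IsDedekindDomain.primesOver_finite (IsLocalRing.maximalIdeal R)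
    (integralClosure R L)).subset ?_
  intro P (hP : P.IsMaximal)
  refine ⟨hP.isPrime, ⟨?_⟩⟩
  have : (P.under R).IsMaximal := Ideal.IsMaximal.under R P
  exact (IsLocalRing.eq_maximalIdeal this).symm

/-- The fractional ideal generated by the conjugates of `z` is principal, and its `n`-th power,
being Galois stable, is generated by a power of the uniformizer. Here `n = [L : F]`, the generator
is `w`, and `c` is the exponent of that power. -/
theorem exists_generator_of_conjugates {ϖ : R} (hϖ : Irreducible ϖ) {z : L} (hz : z ≠ 0) :
    ∃ (w : L) (c : ℤ), w ≠ 0 ∧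
      IsIntegralUnit R (w ^ Module.finrank F L * (algebraMap R L ϖ) ^ (-c)) ∧
      IsIntegral R (z / w) ∧
      ∃ g : (L ≃ₐ[F] L) → L, (∀ σ, IsIntegral R (g σ)) ∧ w = ∑ σ, g σ * σ z := by
  have hpid : IsPrincipalIdealRing (integralClosure R L) :=
    isPrincipalIdealRing_integralClosure_of_isDiscreteValuationRing (F := F)
  have : FaithfulSMul R L := (faithfulSMul_iff_algebraMap_injective R L).mpr (by
    rw [IsScalarTower.algebraMap_eq R F L]
    exact (algebraMap F L).injective.comp (IsFractionRing.injective R F))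
  have : Algebra.IsAlgebraic R L := (IsFractionRing.comap_isAlgebraic_iff (A := R) (K := F)).mpr
    inferInstance
  have hϖ0 : algebraMap R L ϖ ≠ 0 := by simpa using hϖ.ne_zero
  obtain ⟨r, hr0, hr⟩ := (Algebra.IsAlgebraic.isAlgebraic (R := R) z).exists_integral_multiple
  have hr0' : algebraMap R L r ≠ 0 := by simpa using hr0
  let v : (L ≃ₐ[F] L) → integralClosure R L := fun σ ↦ ⟨σ (r • z), hr.algEquiv σ⟩
  obtain ⟨y, hy⟩ := (hpid.principal (Ideal.span (Set.range v))).principal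
  have hv : ∀ σ, y ∣ v σ := fun σ ↦ by
    rw [← Ideal.mem_span_singleton]
    change v σ ∈ Submodule.span _ _
    rw [← hy]
    exact Ideal.subset_span ⟨σ, rfl⟩
  have hyI : y ∈ Ideal.span (Set.range v) := by rw [hy]; exact Submodule.mem_span_singleton_self _
  obtain ⟨g, hg⟩ := Ideal.mem_span_range_iff_exists_fun.mp hyI
  have hg' : (y : L) = ∑ σ, (g σ : L) * σ (r • z) := by
    rw [← hg]; simp [v]
  have hy0 : (y : L) ≠ 0 := by
    intro h0
    obtain ⟨a, ha⟩ := hv 1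
    have h1 : r • z = (y : L) * (a : L) := congrArg Subtype.val ha
    rw [h0, zero_mul, Algebra.smul_def] at h1
    exact (mul_ne_zero hr0' hz) h1
  have hconj : ∀ τ : L ≃ₐ[F] L, IsIntegral R (τ (y : L) / y) := by
    intro τ
    choose a ha using hv
    have ha' : ∀ σ : L ≃ₐ[F] L, σ (r • z) = (y : L) * a σ := fun σ ↦ congrArg Subtype.val (ha σ)
    have h1 : τ (y : L) / y = ∑ σ, τ (g σ : L) * a (τ * σ) := by
      rw [div_eq_iff hy0, Finset.sum_mul]
      conv_lhs => rw [hg']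
      rw [map_sum]
      refine Finset.sum_congr rfl fun σ _ ↦ ?_
      rw [map_mul, ← AlgEquiv.mul_apply, ha']
      ring
    rw [h1]
    exact IsIntegral.sum _ fun σ _ ↦ ((g σ).2.algEquiv τ).mul (a _).2
  have hunit : ∀ τ : L ≃ₐ[F] L, IsIntegralUnit R ((y : L) / τ (y : L)) := by
    intro τ
    have hτ : τ (y : L) ≠ 0 := by simpa using hy0
    refine ⟨div_ne_zero hy0 hτ, ?_, by rw [inv_div]; exact hconj τ⟩
    have := (hconj τ⁻¹).algEquiv τ
    rwa [map_div₀, ← AlgEquiv.mul_apply, mul_inv_cancel, AlgEquiv.one_apply] at this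
  have hnorm : IsIntegral R (Algebra.norm F (y : L)) := Algebra.isIntegral_norm F y.2
  obtain ⟨m, hm⟩ := IsIntegrallyClosed.isIntegral_iff.mp hnorm
  have hmL : algebraMap R L m = ∏ τ : L ≃ₐ[F] L, τ (y : L) := by
    rw [IsScalarTower.algebraMap_apply R F L, hm, Algebra.norm_eq_prod_automorphisms]
  have hm0 : m ≠ 0 := by
    rintro rfl
    rw [map_zero, eq_comm, Finset.prod_eq_zero_iff] at hmL
    obtain ⟨τ, -, h⟩ := hmL
    exact hy0 (by simpa using h)
  have hypow : IsIntegralUnit R ((y : L) ^ Module.finrank F L / algebraMap R L m) := by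
    have h1 : (y : L) ^ Module.finrank F L / algebraMap R L m =
        ∏ τ : L ≃ₐ[F] L, ((y : L) / τ (y : L)) := by
      rw [hmL, Finset.prod_div_distrib, Finset.prod_const, Finset.card_univ,
        ← Nat.card_eq_fintype_card, IsGalois.card_aut_eq_finrank]
    rw [h1]
    exact IsIntegralUnit.prod _ fun τ _ ↦ hunit τ
  obtain ⟨k, u, hu⟩ := IsDiscreteValuationRing.eq_unit_mul_pow_irreducible hm0 hϖ
  obtain ⟨l, u', hu'⟩ := IsDiscreteValuationRing.eq_unit_mul_pow_irreducible hr0 hϖ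
  refine ⟨(y : L) / algebraMap R L r, k - l * Module.finrank F L, div_ne_zero hy0 hr0', ?_, ?_,
    fun σ ↦ g σ, fun σ ↦ (g σ).2, ?_⟩
  · have h1 : IsIntegralUnit R (algebraMap R L u) := .of_isUnit u.isUnit
    have h2 : IsIntegralUnit R (algebraMap R L u') := .of_isUnit u'.isUnit
    have h3 := (hypow.mul h1).mul (h2.pow (Module.finrank F L)).inv
    convert h3 using 1
    rw [hu, hu', neg_sub, zpow_sub₀ hϖ0, zpow_mul, map_mul, map_mul, map_pow, map_pow]
    simp only [zpow_natCast, div_pow, mul_pow]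
    have := h1.1
    have := h2.1
    field_simp
  · obtain ⟨a, ha⟩ := hv 1
    have h1 : r • z = (y : L) * (a : L) := congrArg Subtype.val ha
    rw [Algebra.smul_def] at h1
    have h2 : z / ((y : L) / algebraMap R L r) = a := by
      field_simp
      rw [mul_comm, h1]
    rw [h2]
    exact a.2
  · rw [hg', div_eq_iff hr0', Finset.sum_mul]
    refine Finset.sum_congr rfl fun σ _ ↦ ?_
    rw [Algebra.smul_def, map_mul, IsScalarTower.algebraMap_apply R F L, AlgEquiv.commutes]
    ring

/-- If `n = [L : F]` is invertible in the discrete valuation ring `R`, with `v(ϖ) = 1`, then all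
elements `z` of the dual under the trace of the lattice of all `t` with `n * v(t) ≥ -a` satisfy
`n * v(z) ≥ a + 1 - n`. This is the tameness of `L / F`: the dual is Galois stable, and if it were
larger it would contain an element `w` with `(ϖ * w)⁻¹` in the lattice, so that the trace of `ϖ⁻¹`,
which is `n / ϖ`, would be integral. -/
theorem isIntegral_of_forall_trace_of_isDiscreteValuationRing
    (hn : IsUnit (Module.finrank F L : R)) {ϖ : R} (hϖ : Irreducible ϖ) (a : ℤ) (z : L)
    (h : ∀ t : L, IsIntegral R (t ^ Module.finrank F L * algebraMap R L ϖ ^ a) →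
      IsIntegral R (Algebra.trace F L (z * t))) :
    IsIntegral R (z ^ Module.finrank F L * algebraMap R L ϖ ^ (Module.finrank F L - 1 - a)) := by
  set n := Module.finrank F L with hndef
  have hnpos : 0 < n := Module.finrank_pos
  by_cases hz : z = 0
  · simp [hz, hnpos.ne', isIntegral_zero]
  have hinj : Function.Injective (algebraMap R L) := by
    rw [IsScalarTower.algebraMap_eq R F L]
    exact (algebraMap F L).injective.comp (IsFractionRing.injective R F)
  have hϖ0 : algebraMap R L ϖ ≠ 0 := (map_ne_zero_iff _ hinj).mpr hϖ.ne_zero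
  obtain ⟨w, c, hw0, hwunit, hzw, g, hg, hwsum⟩ :=
    exists_generator_of_conjugates (F := F) hϖ hz
  have htr : ∀ t : L, IsIntegral R (t ^ n * algebraMap R L ϖ ^ a) →
      IsIntegral R (Algebra.trace F L (w * t)) := by
    intro t ht
    rw [hwsum, Finset.sum_mul, map_sum]
    refine IsIntegral.sum _ fun σ _ ↦ ?_
    have h1 : Algebra.trace F L (g σ * σ z * t) =
        Algebra.trace F L (z * σ⁻¹ (g σ * t)) := by
      rw [← Algebra.trace_eq_of_algEquiv σ (z * σ⁻¹ (g σ * t)), map_mul σ, ← AlgEquiv.mul_apply,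
        mul_inv_cancel, AlgEquiv.one_apply]
      congr 1; ring
    rw [h1]
    apply h
    have h2 : (σ⁻¹ (g σ * t)) ^ n * algebraMap R L ϖ ^ a =
        σ⁻¹ (g σ ^ n * (t ^ n * algebraMap R L ϖ ^ a)) := by
      simp only [map_mul, map_pow, map_zpow₀]
      rw [IsScalarTower.algebraMap_apply R F L, AlgEquiv.commutes]
      ring
    rw [h2]
    exact (((hg σ).pow n).mul ht).algEquiv _
  have hca : a - n + 1 ≤ c := by
    by_contra! hlt
    have h1 : IsIntegral R (Algebra.trace F L (w * (algebraMap R L ϖ * w)⁻¹)) := by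
      apply htr
      obtain ⟨e, he⟩ := Int.eq_ofNat_of_zero_le (show 0 ≤ a - n - c by omega)
      have h2 : ((algebraMap R L ϖ * w)⁻¹) ^ n * algebraMap R L ϖ ^ a =
          (w ^ n * algebraMap R L ϖ ^ (-c))⁻¹ * algebraMap R L ϖ ^ e := by
        have h3 : a = n + c + e := by omega
        rw [h3, zpow_add₀ hϖ0, zpow_add₀ hϖ0, zpow_neg, zpow_natCast, zpow_natCast, inv_pow,
          mul_pow, mul_inv, mul_inv, inv_inv]
        have := pow_ne_zero n hϖ0
        field_simp
      rw [h2]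
      exact hwunit.2.2.mul (isIntegral_algebraMap.pow e)
    have h2 : w * (algebraMap R L ϖ * w)⁻¹ = algebraMap F L (algebraMap R F ϖ)⁻¹ := by
      rw [map_inv₀, ← IsScalarTower.algebraMap_apply]; field_simp
    rw [h2, Algebra.trace_algebraMap, nsmul_eq_mul] at h1
    obtain ⟨s, hs⟩ := IsIntegrallyClosed.isIntegral_iff.mp h1
    have hϖF : algebraMap R F ϖ ≠ 0 :=
      (map_ne_zero_iff _ (IsFractionRing.injective R F)).mpr hϖ.ne_zero
    have h4 : s * ϖ = (n : R) := by
      apply IsFractionRing.injective R F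
      rw [map_mul, hs, map_natCast, mul_assoc, inv_mul_cancel₀ hϖF, mul_one]
    exact hϖ.not_isUnit (isUnit_of_mul_isUnit_right (h4 ▸ hn))
  obtain ⟨e, he⟩ := Int.eq_ofNat_of_zero_le (show 0 ≤ n - 1 - a + c by omega)
  have h1 : z ^ n * algebraMap R L ϖ ^ ((n : ℤ) - 1 - a) =
      (z / w) ^ n * (w ^ n * algebraMap R L ϖ ^ (-c)) * algebraMap R L ϖ ^ e := by
    have h2 : (n : ℤ) - 1 - a = -c + e := by omega
    rw [h2, zpow_add₀ hϖ0, zpow_natCast, div_pow]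
    field_simp
  rw [h1]
  exact ((hzw.pow n).mul hwunit.2.1).mul (isIntegral_algebraMap.pow e)

end DVR

/-! ### Trace duality at the principal primes of `A` -/

theorem isLocalizedModule_subtype_of_forall_exists_smul_mem {A L : Type*} [CommRing A] [IsDomain A]
    [Field L] [Algebra A L] [FaithfulSMul A L] {J : Submodule A L}
    (hJ : ∀ z : L, ∃ s : A, s ≠ 0 ∧ s • z ∈ J) :
    IsLocalizedModule (nonZeroDivisors A) J.subtype where
  map_units s := by
    have hs : algebraMap A L s ≠ 0 := by simp [nonZeroDivisors.coe_ne_zero s]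
    have := (IsUnit.mk0 _ hs).map (algebraMap L (Module.End L L))
    rw [Module.End.isUnit_iff] at this ⊢
    convert this using 2
    exact funext fun x ↦ (algebraMap_smul L (s : A) x).symm
  surj z := by
    obtain ⟨s, hs, h⟩ := hJ z
    exact ⟨(⟨_, h⟩, ⟨s, mem_nonZeroDivisors_of_ne_zero hs⟩), rfl⟩
  exists_of_eq h := ⟨1, by rw [Subtype.ext h]⟩

theorem faithfulSMul_of_isScalarTower (A F L : Type*) [CommRing A] [Field F] [Algebra A F]
    [IsFractionRing A F] [Field L] [Algebra F L] [Algebra A L] [IsScalarTower A F L] :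
    FaithfulSMul A L := (faithfulSMul_iff_algebraMap_injective A L).mpr (by
  rw [IsScalarTower.algebraMap_eq A F L]
  exact (algebraMap F L).injective.comp (IsFractionRing.injective A F))

section Trace

variable {A F L : Type*} [CommRing A] [IsDomain A] [Field F] [Algebra A F] [IsFractionRing A F]
  [Field L] [Algebra F L] [Algebra A L] [IsScalarTower A F L] [FiniteDimensional F L]
  [Algebra.IsSeparable F L]

/-- Functionals on a lattice that spans `L` extend to `L`, hence are given by the trace form. -/
theorem exists_forall_trace_mul_eq {J : Submodule A L}
    (hJ : ∀ z : L, ∃ s : A, s ≠ 0 ∧ s • z ∈ J) (g : J →ₗ[A] A) :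
    ∃ w : L, ∀ t : J, Algebra.trace F L (w * t) = algebraMap A F (g t) := by
  have := faithfulSMul_of_isScalarTower A F L
  have := isLocalizedModule_subtype_of_forall_exists_smul_mem hJ
  let φ : L →ₗ[A] F := IsLocalizedModule.lift (nonZeroDivisors A) J.subtype
    ((Algebra.linearMap A F).comp g) (fun s ↦ by
      have hs : algebraMap A F s ≠ 0 := by simp [nonZeroDivisors.coe_ne_zero s]
      have := (IsUnit.mk0 _ hs).map (algebraMap F (Module.End F F))
      rw [Module.End.isUnit_iff] at this ⊢
      convert this using 2
      exact funext fun x ↦ (algebraMap_smul F (s : A) x).symm)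
  have hφ : ∀ t : J, φ t = algebraMap A F (g t) := fun t ↦
    IsLocalizedModule.lift_apply _ J.subtype _ _ t
  let ψ : L →ₗ[F] F := φ.extendScalarsOfIsLocalization (nonZeroDivisors A) F
  let w := (LinearMap.BilinForm.toDual (Algebra.traceForm F L)
    (traceForm_nondegenerate F L)).symm ψ
  refine ⟨w, fun t ↦ ?_⟩
  rw [← hφ]
  exact LinearMap.BilinForm.apply_toDual_symm_apply (hB := traceForm_nondegenerate F L) ψ (t : L)

omit [IsDomain A] in
theorem eq_zero_of_forall_trace_mul_eq_zero {J : Submodule A L}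
    (hJ : ∀ z : L, ∃ s : A, s ≠ 0 ∧ s • z ∈ J) {w : L}
    (h : ∀ t ∈ J, Algebra.trace F L (w * t) = 0) : w = 0 := by
  refine (traceForm_nondegenerate F L).1 w fun z ↦ ?_
  obtain ⟨s, hs, hsz⟩ := hJ z
  have h1 := h _ hsz
  rw [mul_smul_comm, ← algebraMap_smul F s, map_smul, smul_eq_mul] at h1
  have hs' : algebraMap A F s ≠ 0 := by simpa using hs
  exact (mul_eq_zero.mp h1).resolve_left hs'

end Trace

section Local

variable {A F L : Type*} [CommRing A] [IsDomain A] [IsNoetherianRing A] [Field F] [Algebra A F]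
  [IsFractionRing A F] [Field L] [Algebra F L] [Algebra A L] [IsScalarTower A F L]
  [FiniteDimensional F L] [IsGalois F L]

theorem isDiscreteValuationRing_of_prime {R : Type*} [CommRing R] [IsDomain R] [Algebra A R]
    {ϖ : A} (hϖ : Prime ϖ) [(Ideal.span {ϖ}).IsPrime]
    [IsLocalization.AtPrime R (Ideal.span {ϖ})] :
    IsDiscreteValuationRing R ∧ Irreducible (algebraMap A R ϖ) := by
  have : IsLocalRing R := IsLocalization.AtPrime.isLocalRing R (Ideal.span {ϖ})
  have : IsNoetherianRing R :=
    IsLocalization.isNoetherianRing (Ideal.span {ϖ}).primeCompl R inferInstance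
  have hmax : IsLocalRing.maximalIdeal R = Ideal.span {algebraMap A R ϖ} := by
    rw [← IsLocalization.AtPrime.map_eq_maximalIdeal (Ideal.span {ϖ}) R, Ideal.map_span,
      Set.image_singleton]
  have h0 : algebraMap A R ϖ ≠ 0 := by
    rw [Ne, IsLocalization.to_map_eq_zero_iff R
      (Ideal.primeCompl_le_nonZeroDivisors (Ideal.span {ϖ}))]
    exact hϖ.ne_zero
  have hfield : ¬ IsField R := by
    rw [IsLocalRing.isField_iff_maximalIdeal_eq, hmax, Ideal.span_singleton_eq_bot]
    exact h0
  have hdvr : IsDiscreteValuationRing R :=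
    ((IsDiscreteValuationRing.TFAE R hfield).out 4 0).mp
      (show (IsLocalRing.maximalIdeal R).IsPrincipal from ⟨_, hmax⟩)
  exact ⟨hdvr, (IsDiscreteValuationRing.irreducible_iff_uniformizer _).mpr hmax⟩

/-- Elementwise form, at a principal prime of `A`, of
`isIntegral_of_forall_trace_of_isDiscreteValuationRing`. -/
theorem exists_isIntegral_smul_of_forall_trace
    (hn : IsUnit (Module.finrank F L : A)) {ϖ : A} (hϖ : Prime ϖ) (a : ℤ) (z : L)
    (h : ∀ t : L, IsIntegral A (t ^ Module.finrank F L * algebraMap A L ϖ ^ a) →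
      ∃ s : A, ¬ ϖ ∣ s ∧ IsIntegral A (s • Algebra.trace F L (z * t))) :
    ∃ s : A, ¬ ϖ ∣ s ∧
      IsIntegral A (s • (z ^ Module.finrank F L *
        algebraMap A L ϖ ^ (Module.finrank F L - 1 - a))) := by
  have hP : (Ideal.span {ϖ}).IsPrime := (Ideal.span_singleton_prime hϖ.ne_zero).mpr hϖ
  have hmem : ∀ s : A, s ∈ (Ideal.span {ϖ}).primeCompl ↔ ¬ ϖ ∣ s := fun s ↦ by
    rw [← Ideal.mem_span_singleton]; rfl
  have : NeZero (Module.finrank F L) := ⟨Module.finrank_pos.ne'⟩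
  let R := Localization.subalgebra.ofField F (Ideal.span {ϖ}).primeCompl
    (Ideal.primeCompl_le_nonZeroDivisors _)
  have : IsLocalization.AtPrime R (Ideal.span {ϖ}) :=
    Localization.subalgebra.isLocalization_ofField F _ _
  obtain ⟨hdvr, hirr⟩ := isDiscreteValuationRing_of_prime (R := R) hϖ
  have hunit : ∀ s : A, ¬ ϖ ∣ s → IsUnit (algebraMap A R s) := fun s hs ↦
    IsLocalization.map_units R (⟨s, (hmem s).mpr hs⟩ : (Ideal.span {ϖ}).primeCompl)
  have hϖL : algebraMap R L (algebraMap A R ϖ) = algebraMap A L ϖ :=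
    (IsScalarTower.algebraMap_apply A R L ϖ).symm
  have key := isIntegral_of_forall_trace_of_isDiscreteValuationRing (R := R) (F := F) (L := L)
    (by simpa using hn.map (algebraMap A R)) hirr a z ?_
  · obtain ⟨s, hs⟩ := IsIntegral.exists_multiple_integral_of_isLocalization
      (Ideal.span {ϖ}).primeCompl _ key
    rw [hϖL] at hs
    exact ⟨s, (hmem s).mp s.2, hs⟩
  · intro t ht
    obtain ⟨⟨s, hs⟩, hst⟩ := IsIntegral.exists_multiple_integral_of_isLocalization
      (Ideal.span {ϖ}).primeCompl _ ht
    rw [hϖL] at hst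
    obtain ⟨s', hs', h'⟩ := h (s • t) (isIntegral_of_isIntegral_smul_pow hst)
    have h1 : IsIntegral R (s' • Algebra.trace F L (z * s • t)) := h'.tower_top
    rw [mul_smul_comm, ← algebraMap_smul F s, map_smul, algebraMap_smul, smul_smul,
      ← algebraMap_smul R (s' * s)] at h1
    obtain ⟨u, hu⟩ := (hunit s' hs').mul (hunit s ((hmem s).mp hs))
    rw [map_mul, ← hu] at h1
    have h2 := h1.smul ((u⁻¹ : Rˣ) : R)
    rwa [smul_smul, Units.inv_mul, one_smul] at h2

end Local

/-! ### Freeness of the lattices, and unramified principal primes -/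

section Coprime

variable {A F L : Type*} [CommRing A] [IsDomain A] [UniqueFactorizationMonoid A] [Field F]
  [Algebra A F] [IsFractionRing A F] [Field L] [Algebra F L] [Algebra A L] [IsScalarTower A F L]

variable (F) in
/-- Integrality over a factorial domain may be checked after multiplication by each of two elements
without a common prime factor. -/
theorem isIntegral_of_smul_of_smul [Algebra.IsAlgebraic F L] {c d : A}
    (hcd : ∀ ϖ : A, Prime ϖ → ϖ ∣ c → ¬ ϖ ∣ d) {z : L} (hc : IsIntegral A (c • z))
    (hd : IsIntegral A (d • z)) : IsIntegral A z := by
  refine isIntegral_of_forall_prime F z fun ϖ hϖ ↦ ?_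
  by_cases h : ϖ ∣ c
  · exact ⟨d, hcd ϖ hϖ h, hd⟩
  · exact ⟨c, h, hc⟩

variable (F) in
/-- The lattices are reflexive, being defined by conditions at height-one primes; over a regular
local ring of dimension two they are therefore free. -/
theorem free_powLattice [IsLocalRing A] [IsNoetherianRing A] [Algebra.IsAlgebraic F L]
    [Module.Finite A (integralClosure A L)] {n : ℕ} [NeZero n] {π : A}
    (hπ : Prime π) [IsPrincipalIdealRing (A ⧸ Ideal.span {π})] {x : L} (hx : x ≠ 0) :
    Module.Free A (powLattice A n x) := by
  have : FaithfulSMul A L := faithfulSMul_of_isScalarTower A F L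
  have : Algebra.IsAlgebraic A L := (IsFractionRing.comap_isAlgebraic_iff (A := A) (K := F)).mpr
    inferInstance
  have : Module.Finite A (powLattice A n x) := finite_powLattice hx
  have : IsDomain (A ⧸ Ideal.span {π}) := (Ideal.Quotient.isDomain_iff_prime _).mpr
    ((Ideal.span_singleton_prime hπ.ne_zero).mpr hπ)
  have hπL : algebraMap A L π ≠ 0 := by simpa using hπ.ne_zero
  refine free_of_torsionFree_quotient (π := π) hπ.not_isUnit ?_ ?_
  · intro t ht
    have h1 : π • (t : L) = 0 := congrArg Subtype.val ht
    rw [Algebra.smul_def] at h1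
    exact Subtype.ext ((mul_eq_zero.mp h1).resolve_left hπL)
  · intro c s t hc hst
    have h1 : c • (s : L) = π • (t : L) := congrArg Subtype.val hst
    have h2 : π • ((algebraMap A L π)⁻¹ * (s : L)) = s := by
      rw [Algebra.smul_def, mul_inv_cancel_left₀ hπL]
    have h3 : c • ((algebraMap A L π)⁻¹ * (s : L)) = t := by
      rw [← mul_smul_comm, h1, Algebra.smul_def, inv_mul_cancel_left₀ hπL]
    refine ⟨⟨(algebraMap A L π)⁻¹ * (s : L), ?_⟩, Subtype.ext h2.symm⟩
    rw [mem_powLattice]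
    refine isIntegral_of_smul_of_smul F (c := π ^ n) (d := c ^ n) ?_ ?_ ?_
    · intro ϖ hϖ h4 h5
      have h6 := hϖ.dvd_of_dvd_pow h4
      have h7 := hϖ.dvd_of_dvd_pow h5
      exact hc (((hϖ.associated_of_dvd hπ h6).symm.dvd).trans h7)
    · rw [← smul_mul_assoc, ← smul_pow, h2]
      exact s.2
    · rw [← smul_mul_assoc, ← smul_pow, h3]
      exact t.2

end Coprime

/-- At an unramified prime of the form `(ϖ)`, the ideal `ϖ B` is radical locally at `ϖ`. -/
theorem exists_smul_eq_of_unramifiedAtPrime {A L : Type*} [CommRing A] [IsDomain A] [Field L]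
    [Algebra A L] [Module.Finite A (integralClosure A L)] {ϖ : A} (hϖ : Prime ϖ)
    (h : UnramifiedAtPrime A L (Ideal.span {ϖ})) {k : ℕ} {y b : integralClosure A L}
    (hyb : y ^ k = ϖ • b) : ∃ s : A, ¬ ϖ ∣ s ∧ ∃ c : integralClosure A L, s • y = ϖ • c := by
  let B := integralClosure A L
  have hP : (Ideal.span {ϖ}).IsPrime := (Ideal.span_singleton_prime hϖ.ne_zero).mpr hϖ
  let I : Ideal B := (Ideal.span {algebraMap A B ϖ}).colon {y}
  have hI : ∀ t : B, t ∈ I ↔ algebraMap A B ϖ ∣ t * y := fun t ↦ by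
    rw [Submodule.mem_colon_singleton, smul_eq_mul, Ideal.mem_span_singleton]
  by_contra! hcon
  have hdisj : Disjoint (I : Set B) ((Ideal.span {ϖ}).primeCompl.map (algebraMap A B)) := by
    rw [Set.disjoint_left]
    rintro _ hs ⟨s, hs', rfl⟩
    obtain ⟨c, hc⟩ := (hI _).mp hs
    refine hcon s (fun hdvd ↦ hs' (Ideal.mem_span_singleton.mpr hdvd)) c ?_
    rw [Algebra.smul_def, Algebra.smul_def]; exact hc
  obtain ⟨q, hq, hIq, hqdisj⟩ := Ideal.exists_le_prime_disjoint I _ hdisj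
  have hϖq : algebraMap A B ϖ ∈ q := hIq ((hI _).mpr (dvd_mul_right _ _))
  have hlies : q.LiesOver (Ideal.span {ϖ}) := by
    refine ⟨le_antisymm ?_ ?_⟩
    · rw [Ideal.span_singleton_le_iff_mem]; exact hϖq
    · intro s hs
      by_contra hs'
      exact Set.disjoint_left.mp hqdisj hs ⟨s, hs', rfl⟩
  have hunr := h q hlies
  let := Localization.AtPrime.algebraOfLiesOver (Ideal.span {ϖ}) q
  have hmap := ((Algebra.isUnramifiedAt_iff_map_eq A (Ideal.span {ϖ}) q).mp hunr).2
  have hyq : y ∈ q := by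
    refine hq.mem_of_pow_mem k ?_
    rw [hyb, Algebra.smul_def]
    exact q.mul_mem_right _ hϖq
  have hy1 : algebraMap B (Localization.AtPrime q) y ∈
      IsLocalRing.maximalIdeal (Localization.AtPrime q) := by
    rw [← Localization.AtPrime.map_eq_maximalIdeal]
    exact Ideal.mem_map_of_mem _ hyq
  rw [← hmap, IsScalarTower.algebraMap_eq A B, ← Ideal.map_map, Ideal.map_span,
    Set.image_singleton,
    IsLocalization.algebraMap_mem_map_algebraMap_iff q.primeCompl (Localization.AtPrime q)] at hy1
  obtain ⟨t, ht, hty⟩ := hy1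
  exact ht (hIq ((hI t).mpr (Ideal.mem_span_singleton.mp hty)))

/-! ### The dual lattices and the dichotomy for their elements -/

section Dual

variable {A F L : Type*} [CommRing A] [IsDomain A] [IsNoetherianRing A]
  [UniqueFactorizationMonoid A] [Field F] [Algebra A F]
  [IsFractionRing A F] [Field L] [Algebra F L] [Algebra A L] [IsScalarTower A F L]
  [FiniteDimensional F L] [IsGalois F L]

omit [IsDomain A] [IsNoetherianRing A] [UniqueFactorizationMonoid A] in
theorem IsIntegral.mul_zpow_of_le {z : L} {π : A} (hπ : algebraMap A L π ≠ 0) {a b : ℤ}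
    (hab : a ≤ b) (h : IsIntegral A (z * algebraMap A L π ^ a)) :
    IsIntegral A (z * algebraMap A L π ^ b) := by
  obtain ⟨e, he⟩ := Int.eq_ofNat_of_zero_le (sub_nonneg.mpr hab)
  have h2 : b = a + e := by omega
  rw [h2, zpow_add₀ hπ, zpow_natCast, ← mul_assoc]
  exact h.mul (isIntegral_algebraMap.pow e)

omit [UniqueFactorizationMonoid A] in
/-- The tame bound at `π` for the dual of a lattice defined by conditions at `π` and at a second
prime `π'`. The exponent `c` of `π'` is arbitrary since `π'` is invertible at `π`. -/
theorem exists_isIntegral_smul_at_prime (hn : IsUnit (Module.finrank F L : A)) {π π' : A}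
    (hπ : Prime π) (hπ' : Prime π') (hdvd : ¬ π ∣ π') (a b : ℤ) (z : L)
    (h : ∀ t : L, IsIntegral A
        (t ^ Module.finrank F L * (algebraMap A L π ^ a * algebraMap A L π' ^ b)) →
      IsIntegral A (Algebra.trace F L (z * t))) (c : ℤ) :
    ∃ s : A, ¬ π ∣ s ∧ IsIntegral A (s • (z ^ Module.finrank F L *
      (algebraMap A L π ^ (Module.finrank F L - 1 - a) * algebraMap A L π' ^ c))) := by
  have : FaithfulSMul A L := faithfulSMul_of_isScalarTower A F L
  have : NeZero (Module.finrank F L) := ⟨Module.finrank_pos.ne'⟩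
  have hπ0 : algebraMap A L π ≠ 0 := by simpa using hπ.ne_zero
  have hπ'0 : algebraMap A L π' ≠ 0 := by simpa using hπ'.ne_zero
  have hpow : ∀ k : ℕ, ¬ π ∣ π' ^ k := fun k h ↦ hdvd (hπ.dvd_of_dvd_pow h)
  -- A power of `π'` is invertible at `π` and can be used to absorb the factor `π' ^ b`.
  have habsorb : ∀ (y : L) (e : ℤ), IsIntegral A y →
      IsIntegral A (π' ^ e.natAbs • (y * algebraMap A L π' ^ e)) := by
    intro y e hy
    have h1 : π' ^ e.natAbs • (y * algebraMap A L π' ^ e) =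
        y * algebraMap A L π' ^ ((e.natAbs : ℤ) + e) := by
      rw [Algebra.smul_def, map_pow, zpow_add₀ hπ'0, zpow_natCast]; ring
    rw [h1]
    exact IsIntegral.mul_zpow_of_le hπ'0 (a := 0) (by omega) (by simpa using hy)
  obtain ⟨s, hs, hint⟩ := exists_isIntegral_smul_of_forall_trace hn hπ a z fun t ht ↦ by
    refine ⟨π' ^ b.natAbs, hpow _, ?_⟩
    have h1 := h (π' ^ b.natAbs • t) (isIntegral_of_isIntegral_smul_pow (by
      rw [← mul_assoc]
      exact habsorb _ b ht))
    rwa [mul_smul_comm, ← algebraMap_smul F (π' ^ b.natAbs), map_smul, algebraMap_smul] at h1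
  refine ⟨π' ^ c.natAbs * s, fun h ↦ (hπ.dvd_or_dvd h).elim (hpow _) hs, ?_⟩
  have h2 := habsorb _ c hint
  rwa [smul_mul_assoc, smul_smul, mul_assoc] at h2

/-- The dual of the lattice `powLattice A n (π₁ ^ a * π₂ ^ b)` under the trace form of `L / F` is
contained in the lattice that tame ramification along `π₁ π₂` predicts. -/
theorem mem_powLattice_of_forall_trace [Module.Finite A (integralClosure A L)]
    [NeZero (Module.finrank F L)]
    (hn : IsUnit (Module.finrank F L : A)) {π₁ π₂ : A}
    (hπ₁ : Prime π₁) (hπ₂ : Prime π₂) (h12 : ¬ π₁ ∣ π₂) (hram : UnramifiedExceptAt A L {π₁, π₂})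
    (a b : ℤ) (z : L)
    (h : ∀ t ∈ powLattice A (Module.finrank F L) (algebraMap A L π₁ ^ a * algebraMap A L π₂ ^ b),
      IsIntegral A (Algebra.trace F L (z * t))) :
    z ∈ powLattice A (Module.finrank F L)
      (algebraMap A L π₁ ^ (Module.finrank F L - 1 - a) *
        algebraMap A L π₂ ^ (Module.finrank F L - 1 - b)) := by
  have : FaithfulSMul A L := faithfulSMul_of_isScalarTower A F L
  have hπ₁0 : algebraMap A L π₁ ≠ 0 := by simpa using hπ₁.ne_zero
  have hπ₂0 : algebraMap A L π₂ ≠ 0 := by simpa using hπ₂.ne_zero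
  have h21 : ¬ π₂ ∣ π₁ := fun h ↦ h12 (hπ₂.associated_of_dvd hπ₁ h).symm.dvd
  rw [mem_powLattice]
  refine isIntegral_of_forall_prime F _ fun ϖ hϖ ↦ ?_
  by_cases h1 : ϖ ∣ π₁
  · have hass := hϖ.associated_of_dvd hπ₁ h1
    obtain ⟨s, hs, hint⟩ := exists_isIntegral_smul_at_prime hn hπ₁ hπ₂ h12 a b z h
      (Module.finrank F L - 1 - b)
    exact ⟨s, fun hd ↦ hs (hass.symm.dvd.trans hd), hint⟩
  by_cases h2 : ϖ ∣ π₂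
  · have hass := hϖ.associated_of_dvd hπ₂ h2
    obtain ⟨s, hs, hint⟩ := exists_isIntegral_smul_at_prime hn hπ₂ hπ₁ h21 b a z (fun t ht ↦
      h t (by rw [mul_comm]; exact ht)) (Module.finrank F L - 1 - a)
    refine ⟨s, fun hd ↦ hs (hass.symm.dvd.trans hd), ?_⟩
    rwa [mul_comm (algebraMap A L π₂ ^ _)] at hint
  -- At any other prime `ϖ` the tame bound with exponent `0` shows that `ϖ` divides `(ϖ * z) ^ n`.
  -- The extension is unramified there, so `ϖ` divides `ϖ * z` and `z` itself is integral.
  have hpow : ∀ k l : ℕ, ¬ ϖ ∣ π₁ ^ k * π₂ ^ l := fun k l hd ↦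
    (hϖ.dvd_or_dvd hd).elim (fun h ↦ h1 (hϖ.dvd_of_dvd_pow h)) (fun h ↦ h2 (hϖ.dvd_of_dvd_pow h))
  -- Powers of `π₁` and `π₂` are invertible at `ϖ`.
  have habsorb : ∀ (y : L) (e f : ℤ), IsIntegral A y →
      IsIntegral A ((π₁ ^ e.natAbs * π₂ ^ f.natAbs) •
        (y * (algebraMap A L π₁ ^ e * algebraMap A L π₂ ^ f))) := by
    intro y e f hy
    have h1 : (π₁ ^ e.natAbs * π₂ ^ f.natAbs) •
        (y * (algebraMap A L π₁ ^ e * algebraMap A L π₂ ^ f)) =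
        (y * algebraMap A L π₁ ^ ((e.natAbs : ℤ) + e)) *
          algebraMap A L π₂ ^ ((f.natAbs : ℤ) + f) := by
      rw [Algebra.smul_def, map_mul, map_pow, map_pow, zpow_add₀ hπ₁0, zpow_natCast,
        zpow_add₀ hπ₂0, zpow_natCast]
      ring
    rw [h1]
    refine IsIntegral.mul_zpow_of_le hπ₂0 (a := 0) (by omega) ?_
    rw [zpow_zero, mul_one]
    exact IsIntegral.mul_zpow_of_le hπ₁0 (a := 0) (by omega) (by simpa using hy)
  have hP : (Ideal.span {ϖ}).IsPrime := (Ideal.span_singleton_prime hϖ.ne_zero).mpr hϖ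
  have hunr : UnramifiedAtPrime A L (Ideal.span {ϖ}) := by
    refine hram _ ?_
    rintro x (rfl | rfl)
    · rwa [Ideal.mem_span_singleton]
    · rwa [Ideal.mem_span_singleton]
  obtain ⟨s, hs, hint⟩ := exists_isIntegral_smul_of_forall_trace hn hϖ 0 z fun t ht ↦ by
    rw [zpow_zero, mul_one] at ht
    refine ⟨π₁ ^ a.natAbs * π₂ ^ b.natAbs, hpow _ _, ?_⟩
    have h1 := h _ (isIntegral_of_isIntegral_smul_pow (habsorb _ a b ht))
    rwa [mul_smul_comm, ← algebraMap_smul F (π₁ ^ a.natAbs * π₂ ^ b.natAbs), map_smul,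
      algebraMap_smul] at h1
  have hexp : ∃ m, Module.finrank F L = m + 1 :=
    Nat.exists_eq_succ_of_ne_zero (NeZero.ne (Module.finrank F L))
  obtain ⟨m, hm⟩ := hexp
  have hϖ0 : algebraMap A L ϖ ≠ 0 := by simpa using hϖ.ne_zero
  have hint' := (hint.smul (s ^ m))
  rw [smul_smul, ← pow_succ, ← hm, ← smul_mul_assoc, ← smul_pow] at hint'
  have hzpow : algebraMap A L ϖ ^ ((Module.finrank F L : ℤ) - 1 - 0) = algebraMap A L ϖ ^ m := by
    rw [← zpow_natCast]; congr 1; rw [hm]; push_cast; ring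
  rw [hzpow] at hint'
  have hpowint : (ϖ • s • z) ^ Module.finrank F L =
      ϖ • ((s • z) ^ Module.finrank F L * algebraMap A L ϖ ^ m) := by
    rw [Algebra.smul_def ϖ (s • z), mul_pow, Algebra.smul_def ϖ (_ * _), hm]; ring
  have hyint : IsIntegral A (ϖ • s • z) := by
    refine IsIntegral.of_pow (NeZero.pos (Module.finrank F L)) ?_
    rw [hpowint]
    exact hint'.smul ϖ
  obtain ⟨s', hs', ⟨c, hc⟩, hsc⟩ := exists_smul_eq_of_unramifiedAtPrime hϖ hunr
    (k := Module.finrank F L) (y := ⟨_, hyint⟩) (b := ⟨_, hint'⟩) (Subtype.ext hpowint)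
  have hsc' : s' • ϖ • s • z = ϖ • c := congrArg Subtype.val hsc
  have hcz : (s' * s) • z = c := by
    rw [smul_comm s' ϖ, Algebra.smul_def ϖ, Algebra.smul_def ϖ] at hsc'
    rw [mul_smul]
    exact mul_left_cancel₀ hϖ0 hsc'
  have h3 : IsIntegral A ((s' * s) ^ Module.finrank F L • z ^ Module.finrank F L) := by
    rw [← smul_pow, hcz]; exact IsIntegral.pow hc _
  have h4 := habsorb _ (Module.finrank F L - 1 - a) (Module.finrank F L - 1 - b) h3
  rw [smul_mul_assoc, smul_smul] at h4
  refine ⟨_, fun hd ↦ ?_, h4⟩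
  rcases hϖ.dvd_or_dvd hd with hd | hd
  · exact hpow _ _ hd
  · exact (hϖ.dvd_or_dvd (hϖ.dvd_of_dvd_pow hd)).elim hs' hs

/-- An element `z` of the lattice with valuations at least `(a, b) / n` either lies in the span of
the two next smaller lattices, or pairs with an element of the opposite lattice to a unit of `A`
under the trace. Indeed, otherwise `z` defines a functional with values in `(π₁, π₂)` on the
opposite lattice, which is free; so `z = π₁ w₁ + π₂ w₂` with `w₁`, `w₂` in the dual of that
lattice, and the two summands belong to the two smaller lattices. -/
theorem mem_sup_or_exists_isUnit_trace [IsLocalRing A] [Module.Finite A (integralClosure A L)]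
    [NeZero (Module.finrank F L)]
    (hn : IsUnit (Module.finrank F L : A)) {π₁ π₂ : A}
    (hmax : IsLocalRing.maximalIdeal A = Ideal.span {π₁, π₂})
    [IsPrincipalIdealRing (A ⧸ Ideal.span {π₁})]
    (hπ₁ : Prime π₁) (hπ₂ : Prime π₂) (h12 : ¬ π₁ ∣ π₂) (hram : UnramifiedExceptAt A L {π₁, π₂})
    (a b : ℤ) {z : L}
    (hz : z ∈ powLattice A (Module.finrank F L)
      (algebraMap A L π₁ ^ (-a) * algebraMap A L π₂ ^ (-b))) :
    z ∈ powLattice A (Module.finrank F L)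
        (algebraMap A L π₁ ^ (-(a + 1)) * algebraMap A L π₂ ^ (-b)) ⊔
      powLattice A (Module.finrank F L)
        (algebraMap A L π₁ ^ (-a) * algebraMap A L π₂ ^ (-(b + 1))) ∨
    ∃ t ∈ powLattice A (Module.finrank F L) (algebraMap A L π₁ ^ a * algebraMap A L π₂ ^ b),
      ∃ s : A, IsUnit s ∧ algebraMap A F s = Algebra.trace F L (z * t) := by
  have : FaithfulSMul A L := faithfulSMul_of_isScalarTower A F L
  have : Algebra.IsAlgebraic A L := (IsFractionRing.comap_isAlgebraic_iff (A := A) (K := F)).mpr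
    inferInstance
  have hπ₁0 : algebraMap A L π₁ ≠ 0 := by simpa using hπ₁.ne_zero
  have hπ₂0 : algebraMap A L π₂ ≠ 0 := by simpa using hπ₂.ne_zero
  have hx0 : algebraMap A L π₁ ^ a * algebraMap A L π₂ ^ b ≠ 0 :=
    mul_ne_zero (zpow_ne_zero _ hπ₁0) (zpow_ne_zero _ hπ₂0)
  rw [or_iff_not_imp_right]
  intro hno
  set n := Module.finrank F L with hndef
  set J := powLattice A n (algebraMap A L π₁ ^ a * algebraMap A L π₂ ^ b) with hJ
  have hJspan : ∀ z : L, ∃ s : A, s ≠ 0 ∧ s • z ∈ J := exists_smul_mem_powLattice _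
  have hfree : Module.Free A J := free_powLattice F hπ₁ hx0
  have hval : ∀ t : J, ∃ s : A, algebraMap A F s = Algebra.trace F L (z * t) := fun t ↦ by
    have h1 := mul_mem_powLattice hz t.2
    have h2 : (algebraMap A L π₁ ^ (-a) * algebraMap A L π₂ ^ (-b)) *
        (algebraMap A L π₁ ^ a * algebraMap A L π₂ ^ b) = 1 := by
      rw [mul_mul_mul_comm, ← zpow_add₀ hπ₁0, ← zpow_add₀ hπ₂0]; simp
    rw [h2, mem_powLattice_one] at h1
    exact IsIntegrallyClosed.isIntegral_iff.mp (Algebra.isIntegral_trace h1)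
  choose f hf using hval
  let φ : J →ₗ[A] A :=
    { toFun := f
      map_add' := fun s t ↦ IsFractionRing.injective A F (by
        rw [map_add, hf, hf, hf, Submodule.coe_add, mul_add, map_add])
      map_smul' := fun c t ↦ IsFractionRing.injective A F (by
        rw [RingHom.id_apply, smul_eq_mul, map_mul, hf, hf, Submodule.coe_smul, mul_smul_comm,
          ← algebraMap_smul F c, map_smul, smul_eq_mul]) }
  obtain ⟨g₁, g₂, hg⟩ := exists_eq_smul_add_smul_of_free (x := π₁) (y := π₂) φ fun t ↦ by
    rw [← hmax]
    by_contra hu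
    exact hno ⟨t, t.2, f t, IsLocalRing.notMem_maximalIdeal.mp hu, hf t⟩
  obtain ⟨w₁, hw₁⟩ := exists_forall_trace_mul_eq (F := F) hJspan g₁
  obtain ⟨w₂, hw₂⟩ := exists_forall_trace_mul_eq (F := F) hJspan g₂
  have hzw : z = π₁ • w₁ + π₂ • w₂ := by
    rw [← sub_eq_zero]
    refine eq_zero_of_forall_trace_mul_eq_zero (F := F) hJspan fun t ht ↦ ?_
    have h1 : f ⟨t, ht⟩ = π₁ * g₁ ⟨t, ht⟩ + π₂ * g₂ ⟨t, ht⟩ :=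
      LinearMap.congr_fun hg ⟨t, ht⟩
    have h2 := hf ⟨t, ht⟩
    have h3 := hw₁ ⟨t, ht⟩
    have h4 := hw₂ ⟨t, ht⟩
    simp only at h2 h3 h4
    rw [sub_mul, add_mul, map_sub, map_add, smul_mul_assoc, smul_mul_assoc,
      ← algebraMap_smul F π₁, ← algebraMap_smul F π₂, map_smul, map_smul, h3, h4, ← h2, h1,
      map_add, map_mul, map_mul, smul_eq_mul, smul_eq_mul, sub_self]
  have hdual : ∀ (w : L) (g : J →ₗ[A] A),
      (∀ t : J, Algebra.trace F L (w * t) = algebraMap A F (g t)) →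
      IsIntegral A (w ^ n * (algebraMap A L π₁ ^ ((n : ℤ) - 1 - a) *
        algebraMap A L π₂ ^ ((n : ℤ) - 1 - b))) := fun w g hw ↦
    mem_powLattice_of_forall_trace hn hπ₁ hπ₂ h12 hram a b w fun t ht ↦ by
      rw [hw ⟨t, ht⟩]; exact isIntegral_algebraMap
  have hd₁ := hdual w₁ g₁ hw₁
  have hd₂ := hdual w₂ g₂ hw₂
  have hn1 : (1 : ℤ) ≤ n := by exact_mod_cast NeZero.one_le
  have hp₁ : IsIntegral A ((π₁ • w₁) ^ n * algebraMap A L π₁ ^ (-(a + 1)) *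
      algebraMap A L π₂ ^ ((n : ℤ) - 1 - b)) := by
    convert hd₁ using 1
    rw [Algebra.smul_def, mul_pow, ← zpow_natCast (algebraMap A L π₁) n]
    have : (n : ℤ) - 1 - a = n + -(a + 1) := by ring
    rw [this, zpow_add₀ hπ₁0]
    ring
  have hp₂ : IsIntegral A ((π₂ • w₂) ^ n * algebraMap A L π₂ ^ (-(b + 1)) *
      algebraMap A L π₁ ^ ((n : ℤ) - 1 - a)) := by
    convert hd₂ using 1
    rw [Algebra.smul_def, mul_pow, ← zpow_natCast (algebraMap A L π₂) n]
    have : (n : ℤ) - 1 - b = n + -(b + 1) := by ring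
    rw [this, zpow_add₀ hπ₂0]
    ring
  have hcop : ∀ {p p' : A}, Prime p → Prime p' → ¬ p ∣ p' →
      ∀ ϖ : A, Prime ϖ → ϖ ∣ p ^ n → ¬ ϖ ∣ p' ^ n := fun hp hp' hpp' ϖ hϖ h1 h2 ↦
    hpp' ((hϖ.associated_of_dvd hp (hϖ.dvd_of_dvd_pow h1)).symm.dvd.trans (hϖ.dvd_of_dvd_pow h2))
  -- Each summand lies in the smaller lattice up to a power of either parameter, hence lies in it.
  have hstep : ∀ {p q : L} {ρ ρ' : A} {c d : ℤ}, Prime ρ → Prime ρ' → ¬ ρ ∣ ρ' →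
      z = p + q → z ∈ powLattice A n (algebraMap A L ρ ^ (-c) * algebraMap A L ρ' ^ (-d)) →
      IsIntegral A (p ^ n * algebraMap A L ρ ^ (-(c + 1)) *
        algebraMap A L ρ' ^ ((n : ℤ) - 1 - d)) →
      IsIntegral A (q ^ n * algebraMap A L ρ' ^ (-(d + 1)) *
        algebraMap A L ρ ^ ((n : ℤ) - 1 - c)) →
      p ∈ powLattice A n (algebraMap A L ρ ^ (-(c + 1)) * algebraMap A L ρ' ^ (-d)) := by
    intro p q ρ ρ' c d hρ hρ' hρρ' hsum hzc hp hq
    have hρ0 : algebraMap A L ρ ≠ 0 := by simpa using hρ.ne_zero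
    have hρ'0 : algebraMap A L ρ' ≠ 0 := by simpa using hρ'.ne_zero
    have hz' : z ∈ powLattice A n (algebraMap A L ρ' ^ (-d) *
        algebraMap A L ρ ^ ((n : ℤ) - 1 - c)) := by
      rw [mem_powLattice, ← mul_assoc]
      refine IsIntegral.mul_zpow_of_le hρ0 (a := -c) (by omega) ?_
      rw [mul_assoc, mul_comm (algebraMap A L ρ' ^ _)]
      exact hzc
    have hq' : q ∈ powLattice A n (algebraMap A L ρ' ^ (-d) *
        algebraMap A L ρ ^ ((n : ℤ) - 1 - c)) := by
      rw [mem_powLattice, mul_comm (algebraMap A L ρ' ^ _), ← mul_assoc]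
      refine IsIntegral.mul_zpow_of_le hρ'0 (a := -(d + 1)) (by omega) ?_
      rw [mul_right_comm]
      exact hq
    have hp' : p ∈ powLattice A n (algebraMap A L ρ' ^ (-d) *
        algebraMap A L ρ ^ ((n : ℤ) - 1 - c)) := by
      have := Submodule.sub_mem _ hz' hq'
      rwa [hsum, add_sub_cancel_right] at this
    rw [mem_powLattice]
    refine isIntegral_of_smul_of_smul F (hcop hρ hρ' hρρ') ?_ ?_
    · convert mem_powLattice.mp hp' using 1
      have : (n : ℤ) - 1 - c = n + -(c + 1) := by ring
      rw [Algebra.smul_def, map_pow, this, zpow_add₀ hρ0, zpow_natCast]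
      ring
    · have h1 : IsIntegral A (p ^ n * algebraMap A L ρ ^ (-(c + 1)) *
          algebraMap A L ρ' ^ ((n : ℤ) + -d)) :=
        IsIntegral.mul_zpow_of_le hρ'0 (a := (n : ℤ) - 1 - d) (by omega) hp
      convert h1 using 1
      rw [Algebra.smul_def, map_pow, zpow_add₀ hρ'0, zpow_natCast]
      ring
  have h21 : ¬ π₂ ∣ π₁ := fun h ↦ h12 (hπ₂.associated_of_dvd hπ₁ h).symm.dvd
  have hm₁ := hstep hπ₁ hπ₂ h12 hzw hz hp₁ hp₂
  have hm₂ := hstep hπ₂ hπ₁ h21 (by rw [hzw, add_comm])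
    (by rw [mul_comm]; exact hz) hp₂ hp₁
  rw [mul_comm] at hm₂
  rw [hzw]
  exact Submodule.add_mem_sup hm₁ hm₂

end Dual

/-! ### Finite algebras over complete local rings -/

section Complete

open TensorProduct in
/-- A finitely generated module over a complete Noetherian local ring is complete. -/
theorem isAdicComplete_of_finite_of_isLocalRing {A M : Type*} [CommRing A] [IsLocalRing A]
    [IsNoetherianRing A] [IsAdicComplete (IsLocalRing.maximalIdeal A) A] [AddCommGroup M]
    [Module A M] [Module.Finite A M] : IsAdicComplete (IsLocalRing.maximalIdeal A) M := by
  let I := IsLocalRing.maximalIdeal A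
  have hsurj : Function.Surjective (AdicCompletion.of I M) := by
    intro x
    obtain ⟨y, rfl⟩ := AdicCompletion.ofTensorProduct_surjective_of_finite I M x
    induction y with
    | zero => exact ⟨0, by simp⟩
    | add y₁ y₂ h₁ h₂ =>
      obtain ⟨m₁, h₁⟩ := h₁
      obtain ⟨m₂, h₂⟩ := h₂
      exact ⟨m₁ + m₂, by rw [map_add, map_add, h₁, h₂]⟩
    | tmul r m =>
      obtain ⟨r, rfl⟩ := AdicCompletion.of_surjective I A r
      refine ⟨r • m, ?_⟩
      rw [AdicCompletion.ofTensorProduct_tmul, map_smul]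
      ext n
      rfl
  have : IsPrecomplete I M := AdicCompletion.of_surjective_iff.mp hsurj
  exact { toIsHausdorff := inferInstance, toIsPrecomplete := this }

theorem isArtinianRing_quotient_map_maximalIdeal {A B : Type*} [CommRing A] [IsLocalRing A]
    [IsNoetherianRing A] [CommRing B] [Algebra A B] [Module.Finite A B] :
    IsArtinianRing (B ⧸ (IsLocalRing.maximalIdeal A).map (algebraMap A B)) := by
  let I := (IsLocalRing.maximalIdeal A).map (algebraMap A B)
  let : Algebra (IsLocalRing.ResidueField A) (B ⧸ I) :=
    Ideal.Quotient.algebraQuotientOfLEComap Ideal.le_comap_map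
  have : IsScalarTower A (IsLocalRing.ResidueField A) (B ⧸ I) := .of_algebraMap_eq fun _ ↦ rfl
  have : Module.Finite (IsLocalRing.ResidueField A) (B ⧸ I) :=
    Module.Finite.of_restrictScalars_finite A _ _
  exact isArtinian_of_tower (IsLocalRing.ResidueField A) inferInstance

/-- A domain that is Henselian at an ideal with Artinian quotient is local: a nontrivial idempotent
of the quotient would lift. -/
theorem isLocalRing_of_henselianRing_of_isArtinianRing {B : Type*} [CommRing B] [IsDomain B]
    (I : Ideal B) [HenselianRing B I] [IsArtinianRing (B ⧸ I)] : IsLocalRing B := by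
  have hloc : IsLocalHom (Ideal.Quotient.mk I) :=
    isLocalHom_of_le_jacobson_bot I HenselianRing.jac
  refine IsLocalRing.of_isUnit_or_isUnit_one_sub_self fun b ↦ ?_
  let c := Ideal.Quotient.mk I b
  obtain ⟨m, y, hy⟩ := IsArtinian.exists_pow_succ_smul_dvd c (1 : B ⧸ I)
  -- Since the powers of `c` generate a stationary chain of ideals, `c ^ m * y ^ m` is idempotent.
  simp only [smul_eq_mul, mul_one, Nat.succ_eq_add_one] at hy
  have hstab : ∀ k, c ^ (m + k) * y ^ k = c ^ m := by
    intro k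
    induction k with
    | zero => simp
    | succ k ih =>
      calc c ^ (m + (k + 1)) * y ^ (k + 1) = (c ^ (m + 1) * y) * (c ^ k * y ^ k) := by ring
        _ = c ^ (m + k) * y ^ k := by rw [hy]; ring
        _ = c ^ m := ih
  obtain ⟨e, he⟩ := Ideal.Quotient.mk_surjective (I := I) (c ^ m * y ^ m)
  have hidem : (Ideal.Quotient.mk I e) * Ideal.Quotient.mk I e = Ideal.Quotient.mk I e := by
    rw [he]
    calc c ^ m * y ^ m * (c ^ m * y ^ m) = (c ^ (m + m) * y ^ m) * y ^ m := by ring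
      _ = c ^ m * y ^ m := by rw [hstab]
  obtain ⟨r, hr, hre⟩ := HenselianRing.is_henselian (I := I)
    (Polynomial.X ^ 2 - Polynomial.X : Polynomial B) (by monicity!) e
    (by
      rw [← Ideal.Quotient.eq_zero_iff_mem]
      simp [pow_two, hidem])
    (by
      refine IsUnit.of_mul_eq_one (Ideal.Quotient.mk I (2 * e - 1)) ?_
      have hder : (Polynomial.X ^ 2 - Polynomial.X : Polynomial B).derivative.eval e =
          2 * e - 1 := by simp [one_add_one_eq_two]
      rw [hder, map_sub, map_mul, map_one, map_ofNat]
      linear_combination 4 * hidem)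
  have hr' : r * (r - 1) = 0 := by
    have : r ^ 2 - r = 0 := by simpa [Polynomial.IsRoot] using hr
    linear_combination this
  rw [← Ideal.Quotient.eq_zero_iff_mem, map_sub, sub_eq_zero, he] at hre
  rcases mul_eq_zero.mp hr' with h0 | h1
  · right
    rw [h0, map_zero] at hre
    have hc : c ^ m = 0 := by
      calc c ^ m = c ^ m * (c ^ m * y ^ m) := by rw [← mul_assoc, ← pow_add, hstab]
        _ = 0 := by rw [← hre, mul_zero]
    have : IsUnit (1 - c) := IsNilpotent.isUnit_one_sub ⟨m, hc⟩
    refine (isUnit_map_iff (Ideal.Quotient.mk I) _).mp ?_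
    rwa [map_sub, map_one]
  · left
    rw [sub_eq_zero.mp h1, map_one] at hre
    refine (isUnit_map_iff (Ideal.Quotient.mk I) _).mp ?_
    rcases Nat.eq_zero_or_pos m with hm | hm
    · subst hm
      exact IsUnit.of_mul_eq_one y (by simpa using hy)
    · exact isUnit_of_mul_isUnit_left (y := c ^ (m - 1) * y ^ m) (by
        rw [← mul_assoc, mul_pow_sub_one hm.ne', ← hre]; exact isUnit_one)

/-- Units congruent to `1` modulo the maximal ideal have `d`-th roots for `d` invertible: the root
is found by Newton's method in the Artinian quotient and then lifted. -/
theorem exists_pow_eq_of_sub_one_mem {B : Type*} [CommRing B] [IsLocalRing B] (I : Ideal B)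
    [HenselianRing B I] [IsArtinianRing (B ⧸ I)] {d : ℕ} (hd : IsUnit (d : B)) {ε : B}
    (hε : ε - 1 ∈ IsLocalRing.maximalIdeal B) : ∃ η : B, η ^ d = ε := by
  have hloc : IsLocalHom (Ideal.Quotient.mk I) :=
    isLocalHom_of_le_jacobson_bot I HenselianRing.jac
  have hd0 : d ≠ 0 := by rintro rfl; simp at hd
  have hnil : IsNilpotent (Ideal.Quotient.mk I (1 - ε)) := by
    obtain ⟨m, y, hy⟩ := IsArtinian.exists_pow_succ_smul_dvd (Ideal.Quotient.mk I (1 - ε))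
      (1 : B ⧸ I)
    simp only [smul_eq_mul, mul_one, Nat.succ_eq_add_one] at hy
    obtain ⟨y, rfl⟩ := Ideal.Quotient.mk_surjective y
    refine ⟨m, ?_⟩
    have hu : IsUnit (1 - (1 - ε) * y) := by
      have : (1 - ε) * y ∈ IsLocalRing.maximalIdeal B :=
        Ideal.mul_mem_right _ _ (by rw [← neg_sub]; exact neg_mem hε)
      by_contra h
      exact (Ideal.ne_top_iff_one _).mp (IsLocalRing.maximalIdeal.isMaximal B).ne_top (by
        rw [← sub_add_cancel 1 ((1 - ε) * y)]
        exact Ideal.add_mem _ ((IsLocalRing.mem_maximalIdeal _).mpr h) this)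
    refine (hu.map (Ideal.Quotient.mk I)).mul_left_eq_zero.mp ?_
    rw [map_sub _ 1 (_ * y), map_one, map_mul]
    linear_combination -hy
  let P : Polynomial (B ⧸ I) := Polynomial.X ^ d - Polynomial.C (Ideal.Quotient.mk I ε)
  obtain ⟨r, ⟨hr1, hr2⟩, -⟩ := Polynomial.existsUnique_nilpotent_sub_and_aeval_eq_zero
    (x := (1 : B ⧸ I)) (P := P) (by simpa [P] using hnil)
    (by simpa [P, Polynomial.derivative_X_pow] using hd.map (Ideal.Quotient.mk I))
  obtain ⟨r, rfl⟩ := Ideal.Quotient.mk_surjective r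
  have hrpow : Ideal.Quotient.mk I (r ^ d - ε) = 0 := by simpa [P] using hr2
  have hru : IsUnit (Ideal.Quotient.mk I r) := by
    have := hr1.isUnit_one_sub
    rwa [sub_sub_cancel] at this
  obtain ⟨η, hη, -⟩ := HenselianRing.is_henselian (I := I)
    (Polynomial.X ^ d - Polynomial.C ε : Polynomial B) (Polynomial.monic_X_pow_sub_C ε hd0) r
    (by rw [← Ideal.Quotient.eq_zero_iff_mem]; simpa using hrpow)
    (by
      have h1 := (hd.map (Ideal.Quotient.mk I)).mul (hru.pow (d - 1))
      simpa [Polynomial.derivative_X_pow] using h1)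
  refine ⟨η, ?_⟩
  have : η ^ d - ε = 0 := by simpa [Polynomial.IsRoot] using hη
  exact sub_eq_zero.mp this

end Complete

/-! ### The fixed field of inertia -/

theorem isUnit_natCast_of_dvd {A : Type*} [CommRing A] {m n : ℕ} (h : m ∣ n)
    (hn : IsUnit (n : A)) : IsUnit (m : A) :=
  isUnit_of_dvd_unit (Nat.cast_dvd_cast h) hn

theorem IsIntegralUnit.multiset_prod {A L : Type*} [CommRing A] [Field L] [Algebra A L]
    {s : Multiset L} (h : ∀ x ∈ s, IsIntegralUnit A x) : IsIntegralUnit A s.prod := by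
  induction s using Multiset.induction with
  | empty => simpa using IsIntegralUnit.one
  | cons a s ih =>
    rw [Multiset.prod_cons]
    exact (h a (Multiset.mem_cons_self a s)).mul
      (ih fun x hx ↦ h x (Multiset.mem_cons_of_mem hx))

theorem isIntegralUnit_algebraMap_iff {A K L : Type*} [CommRing A] [Field K] [Field L]
    [Algebra A K] [Algebra A L] [Algebra K L] [IsScalarTower A K L] {x : K} :
    IsIntegralUnit A (algebraMap K L x) ↔ IsIntegralUnit A x := by
  rw [IsIntegralUnit, IsIntegralUnit, ← map_inv₀,
    isIntegral_algebraMap_iff (algebraMap K L).injective,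
    isIntegral_algebraMap_iff (algebraMap K L).injective,
    map_ne_zero_iff _ (algebraMap K L).injective]

theorem isIntegralUnit_coe_iff {A L : Type*} [CommRing A] [Field L] [Algebra A L]
    {b : integralClosure A L} : IsIntegralUnit A (b : L) ↔ IsUnit b := by
  constructor
  · rintro ⟨h0, -, h⟩
    exact IsUnit.of_mul_eq_one ⟨_, h⟩ (Subtype.ext (mul_inv_cancel₀ h0))
  · intro h
    obtain ⟨c, hc⟩ := h.exists_right_inv
    have hc' : (b : L) * c = 1 := congrArg Subtype.val hc
    exact ⟨left_ne_zero_of_mul_eq_one hc', b.2, by rw [inv_eq_of_mul_eq_one_right hc']; exact c.2⟩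

section Inertia

variable {A F L : Type*} [CommRing A] [Field F] [Algebra A F] [Field L] [Algebra F L] [Algebra A L]
  [IsScalarTower A F L]

variable [FiniteDimensional F L] [IsGalois F L] [IsLocalRing (integralClosure A L)]

/-- Averaging over a subgroup of order prime to the residue characteristic that acts trivially on
the residue field does not change residue classes. -/
theorem exists_invariant_sub_mem_maximalIdeal (hn : IsUnit (Module.finrank F L : A))
    (H : Subgroup (L ≃ₐ[F] L))
    (hH : ∀ τ ∈ H, ∀ x : IsLocalRing.ResidueField (integralClosure A L), τ • x = x)
    (b : integralClosure A L) : ∃ c : integralClosure A L, (∀ τ ∈ H, τ • c = c) ∧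
      c - b ∈ IsLocalRing.maximalIdeal (integralClosure A L) := by
  classical
  have hcard : IsUnit (Fintype.card H : A) := by
    refine isUnit_natCast_of_dvd ?_ hn
    rw [← IsGalois.card_aut_eq_finrank, ← Nat.card_eq_fintype_card]
    exact H.card_subgroup_dvd_card
  obtain ⟨u, hu⟩ := hcard
  refine ⟨((u⁻¹ : Aˣ) : A) • ∑ τ : H, (τ : L ≃ₐ[F] L) • b, fun τ hτ ↦ ?_, ?_⟩
  · rw [smul_comm, Finset.smul_sum]
    congr 1
    refine Fintype.sum_equiv (Equiv.mulLeft ⟨τ, hτ⟩) _ _ fun σ ↦ ?_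
    rw [smul_smul]; rfl
  · rw [← IsLocalRing.residue_eq_zero_iff, map_sub, Algebra.smul_def, map_mul, map_sum]
    simp_rw [IsLocalRing.ResidueField.residue_smul]
    rw [Finset.sum_congr rfl fun τ _ ↦ hH τ.1 τ.2 _, Finset.sum_const, Finset.card_univ,
      nsmul_eq_mul, ← mul_assoc, ← map_natCast
        ((IsLocalRing.residue (integralClosure A L)).comp (algebraMap A (integralClosure A L))),
      ← hu, RingHom.comp_apply, ← map_mul, ← map_mul, ← map_mul, Units.inv_mul, map_one, one_mul,
      sub_self]

omit [IsGalois F L] in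
/-- There is an element of the residue field whose stabilizer acts trivially, namely a generator
over the fixed field of the Galois group. -/
theorem exists_residue_forall_smul_eq :
    ∃ α : IsLocalRing.ResidueField (integralClosure A L), ∀ σ : L ≃ₐ[F] L, σ • α = α →
      ∀ x : IsLocalRing.ResidueField (integralClosure A L), σ • x = x := by
  let κ := IsLocalRing.ResidueField (integralClosure A L)
  let K := FixedPoints.subfield (L ≃ₐ[F] L) κ
  obtain ⟨α, hα⟩ := Field.exists_primitive_element K κ
  refine ⟨α, fun σ hσ x ↦ ?_⟩
  have hx : x ∈ IntermediateField.adjoin K {α} := hα ▸ IntermediateField.mem_top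
  induction hx using IntermediateField.adjoin_induction with
  | mem y hy => rw [Set.mem_singleton_iff.mp hy, hσ]
  | algebraMap y => exact y.2 σ
  | add y z _ _ hy hz => rw [smul_add, hy, hz]
  | inv y _ hy => rw [smul_inv'', hy]
  | mul y z _ _ hy hz => rw [smul_mul', hy, hz]

/-- There is an integral element `θ` generating the fixed field of the inertia group whose
different conjugates stay different in the residue field, and `F(θ)` has the same residue field as
`L`. Both properties come from averaging over the inertia group, whose order is prime to the residue
characteristic. -/
theorem exists_generator_inertia_field (hn : IsUnit (Module.finrank F L : A)) :
    ∃ θ : L, IsIntegral A θ ∧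
      (∀ σ : L ≃ₐ[F] L, σ θ ≠ θ → IsIntegralUnit A (θ - σ θ)) ∧
      ∀ b : integralClosure A L, ∃ c : integralClosure A L,
        (c : L) ∈ IntermediateField.adjoin F {θ} ∧
        c - b ∈ IsLocalRing.maximalIdeal (integralClosure A L) := by
  let κ := IsLocalRing.ResidueField (integralClosure A L)
  let I : Subgroup (L ≃ₐ[F] L) := (MulAction.toPermHom (L ≃ₐ[F] L) κ).ker
  have hI : ∀ σ, σ ∈ I ↔ ∀ x : κ, σ • x = x := fun σ ↦ by
    rw [MonoidHom.mem_ker, Equiv.ext_iff]; rfl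
  obtain ⟨α, hα⟩ := exists_residue_forall_smul_eq (A := A) (F := F) (L := L)
  obtain ⟨b, rfl⟩ := IsLocalRing.residue_surjective α
  obtain ⟨θ, hθI, hθb⟩ := exists_invariant_sub_mem_maximalIdeal hn I (fun τ hτ ↦ (hI τ).mp hτ) b
  have hres : IsLocalRing.residue _ θ = IsLocalRing.residue _ b := by
    rwa [← sub_eq_zero, ← map_sub, IsLocalRing.residue_eq_zero_iff]
  have hfix : ∀ σ : L ≃ₐ[F] L, IsLocalRing.residue _ (σ • θ) = IsLocalRing.residue _ θ → σ ∈ I := by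
    intro σ hσ
    rw [IsLocalRing.ResidueField.residue_smul, hres] at hσ
    exact (hI σ).mpr (hα σ hσ)
  refine ⟨θ, θ.2, fun σ hσ ↦ ?_, fun b ↦ ?_⟩
  · have hunit : IsUnit (θ - σ • θ) := by
      by_contra h
      have h1 : θ - σ • θ ∈ IsLocalRing.maximalIdeal (integralClosure A L) := h
      rw [← IsLocalRing.residue_eq_zero_iff, map_sub, sub_eq_zero] at h1
      exact hσ (congrArg Subtype.val (hθI σ (hfix σ h1.symm)))
    exact isIntegralUnit_coe_iff.mpr hunit
  · obtain ⟨c, hcI, hc⟩ := exists_invariant_sub_mem_maximalIdeal hn I (fun τ hτ ↦ (hI τ).mp hτ) b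
    refine ⟨c, ?_, hc⟩
    rw [← IsGalois.fixedField_fixingSubgroup (IntermediateField.adjoin F {(θ : L)}),
      IntermediateField.mem_fixedField_iff]
    intro σ hσ
    rw [IntermediateField.mem_fixingSubgroup_iff] at hσ
    have h1 : σ • θ = θ := Subtype.ext (hσ θ (IntermediateField.mem_adjoin_simple_self F (θ : L)))
    exact congrArg Subtype.val (hcI σ (hfix σ (by rw [h1])))

end Inertia

/-! ### Unramifiedness of simple extensions -/

theorem isScalarTower_intermediateField {A F L : Type*} [CommRing A] [Field F] [Algebra A F]
    [Field L] [Algebra F L] [Algebra A L] [IsScalarTower A F L] (K : IntermediateField F L) :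
    IsScalarTower A K L :=
  .of_algebraMap_eq fun x ↦ by
    rw [IsScalarTower.algebraMap_apply A F K, ← IsScalarTower.algebraMap_apply F K L,
      ← IsScalarTower.algebraMap_apply A F L]

/-- An integral primitive element whose discriminant is a unit generates the integral closure. -/
theorem adjoin_singleton_eq_top_of_isIntegralUnit_discr {A F K : Type*} [CommRing A]
    [IsIntegrallyClosed A] [IsDomain A] [Field F] [Algebra A F] [IsFractionRing A F] [Field K]
    [Algebra F K] [Algebra A K] [IsScalarTower A F K] [FiniteDimensional F K]
    [Algebra.IsSeparable F K] (pb : PowerBasis F K) (hint : IsIntegral A pb.gen)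
    (hdiscr : IsIntegralUnit A (Algebra.discr F pb.basis)) :
    Algebra.adjoin A {(⟨pb.gen, hint⟩ : integralClosure A K)} = ⊤ := by
  obtain ⟨a, ha⟩ := IsIntegrallyClosed.isIntegral_iff.mp hdiscr.2.2
  rw [eq_top_iff]
  rintro ⟨z, hz⟩ -
  have h1 := Algebra.discr_mul_isIntegral_mem_adjoin F hint hz
  have h2 : z ∈ Algebra.adjoin A {pb.gen} := by
    have h3 := Subalgebra.smul_mem _ h1 a
    rwa [← algebraMap_smul F a, ha, smul_smul, inv_mul_cancel₀ hdiscr.1, one_smul] at h3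
  have h4 : Algebra.adjoin A {pb.gen} =
      (Algebra.adjoin A {(⟨pb.gen, hint⟩ : integralClosure A K)}).map
        (integralClosure A K).val := by
    rw [AlgHom.map_adjoin, Set.image_singleton]; rfl
  rw [h4] at h2
  obtain ⟨w, hw, hwz⟩ := h2
  have h5 : w = ⟨z, hz⟩ := Subtype.ext hwz
  exact h5 ▸ hw

/-- The differential of `f(θ) = 0` shows that `dθ = 0`, so there are no Kähler differentials. -/
theorem formallyUnramified_of_adjoin_singleton_eq_top {A B : Type*} [CommRing A] [CommRing B]
    [Algebra A B] {θ : B} (hθ : Algebra.adjoin A {θ} = ⊤) {f : Polynomial A}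
    (hf : Polynomial.aeval θ f = 0) (hf' : IsUnit (Polynomial.aeval θ f.derivative)) :
    Algebra.FormallyUnramified A B := by
  have h1 : KaehlerDifferential.D A B θ = 0 := by
    have h2 := (KaehlerDifferential.D A B).map_aeval f θ
    rw [hf, map_zero] at h2
    exact (hf'.smul_eq_zero).mp h2.symm
  have h3 : ∀ x, KaehlerDifferential.D A B x = 0 := fun x ↦ by
    have h4 : Set.EqOn (KaehlerDifferential.D A B) (0 : Derivation A B _) {θ} := by
      rintro _ rfl
      simpa using h1
    exact Derivation.eqOn_adjoin h4 (hθ ▸ Algebra.mem_top)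
  refine ⟨⟨fun x y ↦ ?_⟩⟩
  have h5 : (⊤ : Submodule B (Ω[B⁄A])) = ⊥ := by
    rw [← KaehlerDifferential.span_range_derivation, Submodule.span_eq_bot]
    rintro _ ⟨x, rfl⟩
    exact h3 x
  have h6 : ∀ x : Ω[B⁄A], x = 0 := fun x ↦ (Submodule.mem_bot B).mp (h5 ▸ Submodule.mem_top)
  rw [h6 x, h6 y]

/-- An extension generated by an integral element `θ` whose conjugates differ by units is unramified
everywhere: the derivative of the minimal polynomial of `θ` takes a unit value at `θ`, and the
discriminant is, up to sign, the norm of that value. -/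
theorem unramifiedOn_adjoin_of_forall_isIntegralUnit_sub {A F L : Type*} [CommRing A]
    [IsDomain A] [IsIntegrallyClosed A] [Field F] [Algebra A F]
    [IsFractionRing A F] [Field L] [Algebra F L] [Algebra A L] [IsScalarTower A F L]
    [FiniteDimensional F L] [IsGalois F L] {θ : L} (hθ : IsIntegral A θ)
    (hconj : ∀ σ : L ≃ₐ[F] L, σ θ ≠ θ → IsIntegralUnit A (θ - σ θ)) :
    UnramifiedOn A (IntermediateField.adjoin F {θ}) := by
  classical
  let K := IntermediateField.adjoin F {θ}
  have := isScalarTower_intermediateField (A := A) K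
  have hθF : IsIntegral F θ := Algebra.IsIntegral.isIntegral θ
  let pb : PowerBasis F K := IntermediateField.adjoin.powerBasis hθF
  have hgen : algebraMap K L pb.gen = θ := rfl
  have hint : IsIntegral A pb.gen := by
    rw [← isIntegral_algebraMap_iff (algebraMap K L).injective, hgen]
    exact hθ
  have hderiv : IsIntegralUnit A (Polynomial.aeval pb.gen (minpoly F pb.gen).derivative) := by
    rw [← isIntegralUnit_algebraMap_iff (L := L), ← Polynomial.aeval_algebraMap_apply, hgen]
    have hmin : minpoly F pb.gen = minpoly F θ := by
      rw [← minpoly.algebraMap_eq (algebraMap K L).injective, hgen]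
    have hmon := (minpoly.monic hθF).map (algebraMap F L)
    have hsep : ((minpoly F θ).map (algebraMap F L)).roots.Nodup :=
      Polynomial.nodup_roots (Polynomial.Separable.map (Algebra.IsSeparable.isSeparable F θ))
    rw [hmin, ← Polynomial.eval_map_algebraMap, ← Polynomial.derivative_map,
      (Normal.splits (inferInstance : Normal F L) θ).eval_root_derivative hmon ?_]
    · refine IsIntegralUnit.multiset_prod fun y hy ↦ ?_
      obtain ⟨r, hr, rfl⟩ := Multiset.mem_map.mp hy
      rw [hsep.mem_erase_iff] at hr
      obtain ⟨hne, hr⟩ := hr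
      rw [Polynomial.mem_roots hmon.ne_zero, Polynomial.IsRoot,
        Polynomial.eval_map_algebraMap] at hr
      obtain ⟨σ, rfl⟩ := minpoly.exists_algEquiv_of_root' (Algebra.IsAlgebraic.isAlgebraic θ) hr
      exact hconj σ hne
    · rw [Polynomial.mem_roots hmon.ne_zero, Polynomial.IsRoot, Polynomial.eval_map_algebraMap]
      exact minpoly.aeval F θ
  have hdiscr : IsIntegralUnit A (Algebra.discr F pb.basis) := by
    rw [Algebra.discr_powerBasis_eq_norm]
    refine IsIntegralUnit.mul ?_ ⟨?_, Algebra.isIntegral_norm F hderiv.2.1, ?_⟩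
    · refine IsIntegralUnit.pow ?_ _
      simpa using IsIntegralUnit.of_isUnit (A := A) (L := F) (isUnit_one.neg)
    · exact Algebra.norm_ne_zero_iff.mpr hderiv.1
    · rw [inv_eq_of_mul_eq_one_right (b := Algebra.norm F
        (Polynomial.aeval pb.gen (minpoly F pb.gen).derivative)⁻¹)
        (by rw [← map_mul, mul_inv_cancel₀ hderiv.1, map_one])]
      exact Algebra.isIntegral_norm F hderiv.2.2
  have htop := adjoin_singleton_eq_top_of_isIntegralUnit_discr pb hint hdiscr
  have hminA : (minpoly A pb.gen).map (algebraMap A F) = minpoly F pb.gen :=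
    (minpoly.isIntegrallyClosed_eq_field_fractions' F hint).symm
  have hcoe : ∀ f : Polynomial A, ((Polynomial.aeval (⟨pb.gen, hint⟩ : integralClosure A K) f :
      integralClosure A K) : K) = Polynomial.aeval pb.gen f := fun f ↦
    (Polynomial.aeval_algebraMap_apply K (⟨pb.gen, hint⟩ : integralClosure A K) f).symm
  have hfu : Algebra.FormallyUnramified A (integralClosure A K) := by
    refine formallyUnramified_of_adjoin_singleton_eq_top htop (f := minpoly A pb.gen) ?_ ?_
    · exact Subtype.ext ((hcoe _).trans (minpoly.aeval A pb.gen))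
    · rw [← isIntegralUnit_coe_iff, hcoe, ← Polynomial.aeval_map_algebraMap F,
        ← Polynomial.derivative_map, hminA]
      exact hderiv
  intro p _ _ q _ _
  have : Algebra.FormallyUnramified (integralClosure A K) (Localization.AtPrime q) :=
    Algebra.FormallyUnramified.of_isLocalization q.primeCompl
  exact Algebra.FormallyUnramified.comp A (integralClosure A K) (Localization.AtPrime q)

/-! ### Exponents and generation of `L` -/

section Exponents

variable {A L : Type*} [CommRing A] [Field L] [Algebra A L]

variable (A) in
/-- The element `s` of `L` has `s ^ n` equal to `p ^ a * q ^ b` up to a unit of the integral closure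
of `A`; that is, the divisor of `s` is `1 / n` times that of `p ^ a * q ^ b`. -/
def HasExponents (n : ℕ) (p q s : L) (a b : ℤ) : Prop :=
  IsIntegralUnit A (s ^ n * (p ^ (-a) * q ^ (-b)))

namespace HasExponents

variable {n : ℕ} {p q s t : L} {a b c d : ℤ}

theorem mul (hp : p ≠ 0) (hq : q ≠ 0) (hs : HasExponents A n p q s a b)
    (ht : HasExponents A n p q t c d) : HasExponents A n p q (s * t) (a + c) (b + d) := by
  have h := IsIntegralUnit.mul hs ht
  unfold HasExponents
  rw [neg_add, neg_add, zpow_add₀ hp, zpow_add₀ hq, mul_pow]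
  convert h using 1
  ring

theorem inv (hs : HasExponents A n p q s a b) : HasExponents A n p q s⁻¹ (-a) (-b) := by
  have h := IsIntegralUnit.inv hs
  unfold HasExponents
  rwa [mul_inv, mul_inv, ← zpow_neg, ← zpow_neg, ← inv_pow] at h

theorem zpow (hs : HasExponents A n p q s a b) (k : ℤ) :
    HasExponents A n p q (s ^ k) (a * k) (b * k) := by
  have h := IsIntegralUnit.zpow hs k
  unfold HasExponents
  rwa [mul_zpow, mul_zpow, ← zpow_mul, ← zpow_mul, ← zpow_natCast, ← zpow_mul, mul_comm (n : ℤ) k,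
    zpow_mul, zpow_natCast, neg_mul, neg_mul] at h

theorem pow (hs : HasExponents A n p q s a b) (k : ℕ) :
    HasExponents A n p q (s ^ k) (a * k) (b * k) := by
  simpa using hs.zpow k

theorem of_isIntegralUnit (hs : IsIntegralUnit A s) : HasExponents A n p q s 0 0 := by
  simpa [HasExponents] using hs.pow n

theorem left (hp : p ≠ 0) : HasExponents A n p q p n 0 := by
  have : p ^ n * (p ^ (-(n : ℤ)) * q ^ (-(0 : ℤ))) = 1 := by
    rw [neg_zero, zpow_zero, mul_one, zpow_neg, zpow_natCast, mul_inv_cancel₀ (pow_ne_zero _ hp)]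
  unfold HasExponents
  rw [this]
  exact IsIntegralUnit.one

theorem right (hq : q ≠ 0) : HasExponents A n p q q 0 n := by
  have : q ^ n * (p ^ (-(0 : ℤ)) * q ^ (-(n : ℤ))) = 1 := by
    rw [neg_zero, zpow_zero, one_mul, zpow_neg, zpow_natCast, mul_inv_cancel₀ (pow_ne_zero _ hq)]
  unfold HasExponents
  rw [this]
  exact IsIntegralUnit.one

theorem ne_zero (hn : n ≠ 0) (hs : HasExponents A n p q s a b) : s ≠ 0 := by
  rintro rfl
  exact hs.1 (by simp [hn])

theorem isIntegralUnit_div (hn : n ≠ 0) (hp : p ≠ 0) (hq : q ≠ 0)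
    (hs : HasExponents A n p q s a b) (ht : HasExponents A n p q t a b) :
    IsIntegralUnit A (s / t) := by
  have h := hs.mul hp hq ht.inv
  rw [add_neg_cancel, add_neg_cancel, ← div_eq_mul_inv] at h
  refine IsIntegralUnit.of_pow hn ?_
  simpa [HasExponents] using h

theorem isIntegral_div [NeZero n] {z : L} (hs : HasExponents A n p q s a b)
    (hz : z ∈ powLattice A n (p ^ (-a) * q ^ (-b))) : IsIntegral A (z / s) := by
  have hp0 : p ^ (-a) * q ^ (-b) ≠ 0 := right_ne_zero_of_mul hs.1
  refine IsIntegral.of_pow (NeZero.pos n) ?_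
  have h : (z / s) ^ n = (z ^ n * (p ^ (-a) * q ^ (-b))) * (s ^ n * (p ^ (-a) * q ^ (-b)))⁻¹ := by
    rw [div_pow, mul_inv, mul_mul_mul_comm, mul_inv_cancel₀ hp0, mul_one, div_eq_mul_inv]
  rw [h]
  exact (mem_powLattice.mp hz).mul hs.2.2

theorem mem_powLattice [NeZero n] (hs : HasExponents A n p q s a b) :
    s ∈ powLattice A n (p ^ (-a) * q ^ (-b)) := hs.2.1

end HasExponents

variable (A) in
/-- The group of all pairs `(a, b)` for which `p ^ a * q ^ b` has an `n`-th root in `L` up to a unit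
of the integral closure of `A`. -/
def exponentGroup (n : ℕ) {p q : L} (hp : p ≠ 0) (hq : q ≠ 0) : AddSubgroup (ℤ × ℤ) where
  carrier := {x | ∃ s : L, HasExponents A n p q s x.1 x.2}
  zero_mem' := ⟨1, HasExponents.of_isIntegralUnit IsIntegralUnit.one⟩
  add_mem' := by
    rintro x y ⟨s, hs⟩ ⟨t, ht⟩
    exact ⟨s * t, hs.mul hp hq ht⟩
  neg_mem' := by
    rintro x ⟨s, hs⟩
    exact ⟨s⁻¹, hs.inv⟩

theorem mem_exponentGroup {n : ℕ} {p q : L} {hp : p ≠ 0} {hq : q ≠ 0} {a b : ℤ} :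
    (a, b) ∈ exponentGroup A n hp hq ↔ ∃ s : L, HasExponents A n p q s a b := Iff.rfl

/-- A subgroup `Λ` of `ℤ × ℤ` containing `(n, 0)` and `(0, n)` has a basis `(a₁, 0)`, `(c, b₂)`.
Here `a₁` generates the first coordinates of the elements of `Λ` on the axis and `b₂` all second
coordinates; moreover `d₁ * (a₁, 0) = (n, 0)` and `d₂ * (c, b₂) = i * (a₁, 0) + (0, n)`. -/
theorem exists_triangular_basis (Λ : AddSubgroup (ℤ × ℤ)) {n : ℕ} (hn : n ≠ 0)
    (h1 : ((n : ℤ), (0 : ℤ)) ∈ Λ) (h2 : ((0 : ℤ), (n : ℤ)) ∈ Λ) :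
    ∃ (a₁ b₂ c d₁ d₂ i : ℕ), 0 < d₁ ∧ 0 < d₂ ∧ a₁ * d₁ = n ∧ b₂ * d₂ = n ∧ c * d₂ = a₁ * i ∧
      ((a₁ : ℤ), (0 : ℤ)) ∈ Λ ∧ ((c : ℤ), (b₂ : ℤ)) ∈ Λ ∧
      ∀ a b : ℤ, (a, b) ∈ Λ → ∃ k l : ℤ, a = a₁ * k + c * l ∧ b = b₂ * l := by
  have gen : ∀ H : AddSubgroup ℤ, ∃ g : ℕ, ∀ x : ℤ, x ∈ H ↔ (g : ℤ) ∣ x := fun H ↦ by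
    obtain ⟨g, hg⟩ := Int.subgroup_cyclic H
    refine ⟨g.natAbs, fun x ↦ ?_⟩
    rw [hg, AddSubgroup.mem_closure_singleton, Int.natAbs_dvd]
    exact ⟨fun ⟨k, hk⟩ ↦ ⟨k, by rw [← hk, smul_eq_mul, mul_comm]⟩,
      fun ⟨k, hk⟩ ↦ ⟨k, by rw [hk, smul_eq_mul, mul_comm]⟩⟩
  obtain ⟨a₁, ha₁⟩ := gen (Λ.comap (AddMonoidHom.inl ℤ ℤ))
  obtain ⟨b₂, hb₂⟩ := gen (Λ.map (AddMonoidHom.snd ℤ ℤ))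
  have ha₁' : ∀ x : ℤ, (x, (0 : ℤ)) ∈ Λ ↔ (a₁ : ℤ) ∣ x := fun x ↦ ha₁ x
  obtain ⟨d₁, hd₁⟩ := Int.natCast_dvd_natCast.mp ((ha₁' n).mp h1)
  obtain ⟨d₂, hd₂⟩ := Int.natCast_dvd_natCast.mp ((hb₂ n).mp ⟨_, h2, rfl⟩)
  obtain ⟨⟨c', b'⟩, hc', hb'⟩ := (hb₂ b₂).mpr dvd_rfl
  have hb'' : b' = b₂ := hb'
  subst hb''
  -- Adding a multiple of `(n, 0)` makes the first coordinate nonnegative.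
  have hcmem : (((c' + n * c'.natAbs).toNat : ℤ), (b₂ : ℤ)) ∈ Λ := by
    have h3 : 0 ≤ c' + n * c'.natAbs := by
      have : (1 : ℤ) ≤ n := by exact_mod_cast Nat.one_le_iff_ne_zero.mpr hn
      nlinarith [abs_nonneg c', neg_abs_le c', Int.natCast_natAbs c']
    rw [Int.toNat_of_nonneg h3]
    have h4 := Λ.add_mem hc' (Λ.zsmul_mem h1 (c'.natAbs : ℤ))
    simpa [mul_comm] using h4
  set c := (c' + n * c'.natAbs).toNat
  have hi : (a₁ : ℤ) ∣ ((c * d₂ : ℕ) : ℤ) := by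
    rw [← ha₁']
    have h4 := Λ.sub_mem (Λ.zsmul_mem hcmem (d₂ : ℤ)) h2
    have h5 : ((d₂ : ℤ) • ((c : ℤ), (b₂ : ℤ)) - ((0 : ℤ), (n : ℤ))) = (((c * d₂ : ℕ) : ℤ), 0) := by
      rw [hd₂]
      ext <;> simp [mul_comm]
    rwa [h5] at h4
  obtain ⟨i, hi⟩ := Int.natCast_dvd_natCast.mp hi
  refine ⟨a₁, b₂, c, d₁, d₂, i, ?_, ?_, hd₁.symm, hd₂.symm, hi, (ha₁' _).mpr dvd_rfl, hcmem, ?_⟩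
  · rcases Nat.eq_zero_or_pos d₁ with h | h
    · exact absurd (by rw [hd₁, h, mul_zero]) hn
    · exact h
  · rcases Nat.eq_zero_or_pos d₂ with h | h
    · exact absurd (by rw [hd₂, h, mul_zero]) hn
    · exact h
  · intro a b hab
    obtain ⟨l, hl⟩ := (hb₂ b).mp ⟨_, hab, rfl⟩
    have h6 : (a - c * l, (0 : ℤ)) ∈ Λ := by
      have h7 := Λ.sub_mem hab (Λ.zsmul_mem hcmem l)
      have h8 : ((a, b) - l • ((c : ℤ), (b₂ : ℤ))) = (a - c * l, 0) := by
        rw [hl]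
        ext <;> simp [mul_comm]
      rwa [h8] at h7
    obtain ⟨k, hk⟩ := (ha₁' _).mp h6
    exact ⟨k, l, by rw [← hk]; ring, hl⟩

end Exponents

section Generation

/-- An element of the maximal ideal has its conjugates, hence its trace, in the maximal ideal. -/
theorem isUnit_of_isUnit_trace {A F L : Type*} [CommRing A] [Field F] [Algebra A F] [Field L]
    [Algebra F L] [Algebra A L] [IsScalarTower A F L] [FiniteDimensional F L] [IsGalois F L]
    [IsLocalRing (integralClosure A L)] {b : integralClosure A L} {s : A} (hs : IsUnit s)
    (h : algebraMap A F s = Algebra.trace F L (b : L)) : IsUnit b := by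
  by_contra hb
  have h1 : algebraMap A (integralClosure A L) s = ∑ σ : L ≃ₐ[F] L, σ • b := by
    apply Subtype.ext
    have h2 : algebraMap A L s = ∑ σ : L ≃ₐ[F] L, σ (b : L) := by
      rw [IsScalarTower.algebraMap_apply A F L, h, trace_eq_sum_automorphisms]
    rw [AddSubmonoidClass.coe_finsetSum]
    exact h2
  have h3 : ∀ σ : L ≃ₐ[F] L, σ • b ∈ IsLocalRing.maximalIdeal (integralClosure A L) := fun σ ↦ by
    have hb' : IsLocalRing.residue _ b = 0 := (IsLocalRing.residue_eq_zero_iff b).mpr hb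
    rw [← IsLocalRing.residue_eq_zero_iff, IsLocalRing.ResidueField.residue_smul, hb', smul_zero]
  have h4 : algebraMap A (integralClosure A L) s ∈
      IsLocalRing.maximalIdeal (integralClosure A L) := h1 ▸ Ideal.sum_mem _ fun σ _ ↦ h3 σ
  exact h4 (hs.map _)

variable {A F L : Type*} [CommRing A] [IsDomain A] [IsLocalRing A] [IsNoetherianRing A] [Field F]
  [Algebra A F] [IsFractionRing A F] [Field L] [Algebra F L] [Algebra A L] [IsScalarTower A F L]

/-- An intermediate field `M` is all of `L` if it has enough elements modulo the maximal ideal of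
the integral closure `B` of `A` and contains an element for each pair of exponents that occurs in
`L`. By successive approximation along the filtration of `B` by the lattices, every element of
`B` is congruent to an element of `M` modulo the maximal ideal of `A`, and Nakayama's lemma
applies. -/
theorem eq_top_of_forall_hasExponents [Algebra.IsAlgebraic F L]
    [Module.Finite A (integralClosure A L)]
    [IsLocalRing (integralClosure A L)] {n : ℕ} [NeZero n] {π₁ π₂ : A}
    (hπ₁ : π₁ ∈ IsLocalRing.maximalIdeal A) (hπ₂ : π₂ ∈ IsLocalRing.maximalIdeal A)
    (hp : algebraMap A L π₁ ≠ 0) (hq : algebraMap A L π₂ ≠ 0)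
    (hpure : ∀ (a b : ℤ) (z : L),
      z ∈ powLattice A n (algebraMap A L π₁ ^ (-a) * algebraMap A L π₂ ^ (-b)) →
      z ∈ powLattice A n (algebraMap A L π₁ ^ (-(a + 1)) * algebraMap A L π₂ ^ (-b)) ⊔
        powLattice A n (algebraMap A L π₁ ^ (-a) * algebraMap A L π₂ ^ (-(b + 1))) ∨
      HasExponents A n (algebraMap A L π₁) (algebraMap A L π₂) z a b)
    (M : IntermediateField F L)
    (hres : ∀ b : integralClosure A L, ∃ c : integralClosure A L, (c : L) ∈ M ∧
      c - b ∈ IsLocalRing.maximalIdeal (integralClosure A L))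
    (hexp : ∀ (a b : ℤ) (z : L),
      HasExponents A n (algebraMap A L π₁) (algebraMap A L π₂) z a b →
      ∃ y ∈ M, HasExponents A n (algebraMap A L π₁) (algebraMap A L π₂) y a b) : M = ⊤ := by
  set p := algebraMap A L π₁
  set q := algebraMap A L π₂
  have hpi : IsIntegral A p := isIntegral_algebraMap
  have hqi : IsIntegral A q := isIntegral_algebraMap
  have : FaithfulSMul A L := faithfulSMul_of_isScalarTower A F L
  have : Algebra.IsAlgebraic A L := (IsFractionRing.comap_isAlgebraic_iff (A := A) (K := F)).mpr
    inferInstance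
  let J : ℤ → ℤ → Submodule A L := fun a b ↦ powLattice A n (p ^ (-a) * q ^ (-b))
  have hJ0 : ∀ z : L, z ∈ J 0 0 ↔ IsIntegral A z := fun z ↦ by
    simp only [J, neg_zero, zpow_zero, mul_one]
    exact mem_powLattice_one
  let N : Submodule A L := M.toSubalgebra.toSubmodule.restrictScalars A ⊓ J 0 0
  let m := IsLocalRing.maximalIdeal A
  have hmax : ∀ b : integralClosure A L, b ∈ IsLocalRing.maximalIdeal (integralClosure A L) →
      (b : L) ∈ J 1 0 ⊔ J 0 1 := by
    intro b hb
    rcases hpure 0 0 b ((hJ0 b).mpr b.2) with h | h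
    · simpa [J] using h
    · refine absurd ?_ hb
      rw [← isIntegralUnit_coe_iff]
      exact IsIntegralUnit.of_pow (NeZero.ne n) (by simpa [HasExponents] using h)
  have hmono : ∀ a b : ℕ, J a b ≤ J 0 0 := fun a b z hz ↦ by
    rw [hJ0]
    refine IsIntegral.of_pow (NeZero.pos n) ?_
    have h1 := (mem_powLattice.mp hz).mul ((hpi.pow a).mul (hqi.pow b))
    rwa [mul_assoc, mul_mul_mul_comm (p ^ _), ← zpow_natCast p a, ← zpow_natCast q b,
      zpow_neg_mul_zpow_self _ hp, zpow_neg_mul_zpow_self _ hq, mul_one, mul_one] at h1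
  have hstep : ∀ a b : ℕ, J a b ≤ N ⊔ (J (a + 1) b ⊔ J a (b + 1)) := by
    intro a b z hz
    rcases hpure a b z hz with h | h
    · exact Submodule.mem_sup_right h
    · obtain ⟨y, hyM, hy⟩ := hexp a b z h
      have hy0 : y ≠ 0 := hy.ne_zero (NeZero.ne n)
      obtain ⟨c, hcM, hc⟩ := hres ⟨z / y, hy.isIntegral_div hz⟩
      have h1 : (c : L) - z / y ∈ J 1 0 ⊔ J 0 1 := hmax _ hc
      have hyc : y * c ∈ J a b := by
        rw [mul_comm]; exact c.2.mul_mem_powLattice hy.mem_powLattice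
      have h2 : y * ((c : L) - z / y) ∈ J (a + 1) b ⊔ J a (b + 1) := by
        obtain ⟨u, hu, v, hv, huv⟩ := Submodule.mem_sup.mp h1
        rw [← huv, mul_add]
        refine Submodule.add_mem_sup ?_ ?_
        · have h3 := mul_mem_powLattice hy.mem_powLattice hu
          rw [mul_mul_mul_comm, ← zpow_add₀ hp, ← zpow_add₀ hq, ← neg_add, ← neg_add,
            add_zero] at h3
          exact h3
        · have h3 := mul_mem_powLattice hy.mem_powLattice hv
          rw [mul_mul_mul_comm, ← zpow_add₀ hp, ← zpow_add₀ hq, ← neg_add, ← neg_add,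
            add_zero] at h3
          exact h3
      have h4 : z = y * c - y * ((c : L) - z / y) := by field_simp; ring
      rw [h4]
      exact Submodule.sub_mem _ (Submodule.mem_sup_left ⟨M.mul_mem hyM hcM, hmono a b hyc⟩)
        (Submodule.mem_sup_right h2)
  have hbig : ∀ a b : ℕ, n ≤ a ∨ n ≤ b → J a b ≤ m • J 0 0 := by
    have aux : ∀ {π : A} {z : L}, π ∈ m → algebraMap A L π ≠ 0 →
        IsIntegral A (z ^ n * (algebraMap A L π ^ (-(n : ℤ)))) → z ∈ m • J 0 0 := by
      intro π z hπm hπ0 hz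
      have h1 : (algebraMap A L π)⁻¹ * z ∈ J 0 0 := by
        rw [hJ0]
        refine IsIntegral.of_pow (NeZero.pos n) ?_
        rwa [mul_pow, inv_pow, ← zpow_natCast (algebraMap A L π), ← zpow_neg, mul_comm]
      have h2 := Submodule.smul_mem_smul hπm h1
      have h3 : π • ((algebraMap A L π)⁻¹ * z) = z := by
        rw [Algebra.smul_def, mul_inv_cancel_left₀ hπ0]
      rwa [h3] at h2
    rintro a b (hab | hab) z hz
    · refine aux hπ₁ hp ?_
      have h1 := (mem_powLattice.mp hz).mul ((hpi.pow (a - n)).mul (hqi.pow b))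
      have h2 : -(a : ℤ) + ((a - n : ℕ) : ℤ) = -n := by omega
      rwa [mul_assoc, mul_mul_mul_comm (p ^ _), ← zpow_natCast p (a - n), ← zpow_natCast q b,
        ← zpow_add₀ hp, zpow_neg_mul_zpow_self _ hq, mul_one, h2] at h1
    · refine aux hπ₂ hq ?_
      have h1 := (mem_powLattice.mp hz).mul ((hpi.pow a).mul (hqi.pow (b - n)))
      have h2 : -(b : ℤ) + ((b - n : ℕ) : ℤ) = -n := by omega
      rwa [mul_assoc, mul_mul_mul_comm (p ^ _), ← zpow_natCast p a, ← zpow_natCast q (b - n),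
        ← zpow_add₀ hq, zpow_neg_mul_zpow_self _ hp, one_mul, h2] at h1
  -- Each step raises `a + b`; once `2 * n ≤ a + b`, one of `a`, `b` is at least `n`.
  have hind : ∀ k a b : ℕ, 2 * n ≤ a + b + k → J a b ≤ N ⊔ m • J 0 0 := by
    intro k
    induction k with
    | zero =>
      intro a b hab
      exact (hbig a b (by omega)).trans le_sup_right
    | succ k ih =>
      intro a b hab
      refine (hstep a b).trans (sup_le le_sup_left (sup_le ?_ ?_))
      · exact_mod_cast ih (a + 1) b (by omega)
      · exact_mod_cast ih a (b + 1) (by omega)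
  have hfg : (J 0 0).FG := by
    have : Module.Finite A (J 0 0) := finite_powLattice (by simp)
    exact Module.Finite.iff_fg.mp this
  have hle : J 0 0 ≤ N := Submodule.le_of_le_smul_of_le_jacobson_bot hfg
    (IsLocalRing.maximalIdeal_le_jacobson _) (by exact_mod_cast hind (2 * n) 0 0 (by omega))
  rw [eq_top_iff]
  intro z _
  obtain ⟨s, hs0, hs⟩ :=
    (Algebra.IsAlgebraic.isAlgebraic (R := A) z).exists_integral_multiple
  have h1 : s • z ∈ M := (hle ((hJ0 _).mpr hs)).1
  have h2 : algebraMap A F s ≠ 0 := by simpa using hs0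
  rw [← algebraMap_smul F s] at h1
  have h3 := M.smul_mem h1 (x := (algebraMap A F s)⁻¹)
  rwa [smul_smul, inv_mul_cancel₀ h2, one_smul] at h3

end Generation

/-! ### The Kummer generators -/

section Kummer

variable {A F L : Type*} [CommRing A] [Field F] [Algebra A F] [Field L] [Algebra F L] [Algebra A L]
  [IsScalarTower A F L]

/-- Being a unit of the integral closure of `A` does not depend on the ambient field. -/
theorem exists_unit_coe_eq_of_isIntegralUnit (K : IntermediateField F L) {x : L} (hxK : x ∈ K)
    (hx : IsIntegralUnit A x) :
    ∃ u : (integralClosure A K)ˣ, (((u : integralClosure A K) : K) : L) = x := by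
  have := isScalarTower_intermediateField (A := A) K
  have h : IsIntegralUnit A (⟨x, hxK⟩ : K) := isIntegralUnit_algebraMap_iff (L := L).mp hx
  obtain ⟨u, hu⟩ := isIntegralUnit_coe_iff (b := (⟨⟨x, hxK⟩, h.2.1⟩ : integralClosure A K)).mp h
  exact ⟨u, by rw [hu]⟩

omit [Algebra A F] [IsScalarTower A F L] in
/-- Over a field `K` with full residue field, each unit of the integral closure of `A` in `L` is
the product of a unit in `K` and a `d`-th power, because units congruent to `1` are `d`-th
powers. -/
theorem IsIntegralUnit.exists_eq_mul_pow [IsLocalRing (integralClosure A L)]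
    (I : Ideal (integralClosure A L)) [HenselianRing (integralClosure A L) I]
    [IsArtinianRing (integralClosure A L ⧸ I)] (K : IntermediateField F L)
    (hK : ∀ b : integralClosure A L, ∃ c : integralClosure A L, (c : L) ∈ K ∧
      c - b ∈ IsLocalRing.maximalIdeal (integralClosure A L)) {d : ℕ} (hd : IsUnit (d : A)) {u : L}
    (hu : IsIntegralUnit A u) :
    ∃ u₁ ∈ K, ∃ η : L, IsIntegralUnit A u₁ ∧ IsIntegralUnit A η ∧ u = u₁ * η ^ d := by
  have hd0 : d ≠ 0 := by
    rintro rfl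
    have h1 : IsUnit (algebraMap A L ((0 : ℕ) : A)) := hd.map _
    simp at h1
  let b : integralClosure A L := ⟨u, hu.2.1⟩
  have hb : IsUnit b := isIntegralUnit_coe_iff.mp hu
  obtain ⟨c, hcK, hc⟩ := hK b
  have hcu : IsUnit c := by
    by_contra h
    have h1 : c ∈ IsLocalRing.maximalIdeal (integralClosure A L) := h
    have h2 := Ideal.sub_mem _ h1 hc
    rw [sub_sub_cancel] at h2
    exact h2 hb
  obtain ⟨w, rfl⟩ := hcu
  have h1 : b * ((w⁻¹ : (integralClosure A L)ˣ) : integralClosure A L) - 1 ∈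
      IsLocalRing.maximalIdeal (integralClosure A L) := by
    have h2 := Ideal.mul_mem_right (-((w⁻¹ : (integralClosure A L)ˣ) : integralClosure A L)) _ hc
    rwa [sub_mul, mul_neg, mul_neg, Units.mul_inv, neg_sub_neg] at h2
  have hd' : IsUnit (d : integralClosure A L) := by
    simpa using hd.map (algebraMap A (integralClosure A L))
  obtain ⟨η, hη⟩ := exists_pow_eq_of_sub_one_mem I hd' h1
  refine ⟨(w : integralClosure A L), hcK, η, isIntegralUnit_coe_iff.mpr w.isUnit, ?_, ?_⟩
  · rw [isIntegralUnit_coe_iff]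
    refine (isUnit_pow_iff hd0).mp ?_
    rw [hη]
    exact hb.mul w⁻¹.isUnit
  · have h2 : b = w * η ^ d := by rw [hη, mul_comm b, Units.mul_inv_cancel_left]
    exact congrArg Subtype.val h2

variable [IsDomain A] [IsLocalRing A] [IsNoetherianRing A] [UniqueFactorizationMonoid A]
  [IsFractionRing A F] [FiniteDimensional F L] [IsGalois F L]

/-- Outside the two next smaller lattices, the elements of the lattice with valuations at least
`(a, b) / n` have exponents exactly `(a, b)`: an element which pairs with `t` to a unit under the
trace has a unit as its product with `t`. -/
theorem mem_sup_or_hasExponents [Module.Finite A (integralClosure A L)]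
    [IsLocalRing (integralClosure A L)] [NeZero (Module.finrank F L)]
    (hn : IsUnit (Module.finrank F L : A)) {π₁ π₂ : A}
    (hmax : IsLocalRing.maximalIdeal A = Ideal.span {π₁, π₂})
    [IsPrincipalIdealRing (A ⧸ Ideal.span {π₁})]
    (hπ₁ : Prime π₁) (hπ₂ : Prime π₂) (h12 : ¬ π₁ ∣ π₂) (hram : UnramifiedExceptAt A L {π₁, π₂})
    (a b : ℤ) {z : L}
    (hz : z ∈ powLattice A (Module.finrank F L)
      (algebraMap A L π₁ ^ (-a) * algebraMap A L π₂ ^ (-b))) :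
    z ∈ powLattice A (Module.finrank F L)
        (algebraMap A L π₁ ^ (-(a + 1)) * algebraMap A L π₂ ^ (-b)) ⊔
      powLattice A (Module.finrank F L)
        (algebraMap A L π₁ ^ (-a) * algebraMap A L π₂ ^ (-(b + 1))) ∨
    HasExponents A (Module.finrank F L) (algebraMap A L π₁) (algebraMap A L π₂) z a b := by
  refine (mem_sup_or_exists_isUnit_trace hn hmax hπ₁ hπ₂ h12 hram a b hz).imp_right ?_
  rintro ⟨t, ht, s, hs, hst⟩
  set n := Module.finrank F L
  have : FaithfulSMul A L := faithfulSMul_of_isScalarTower A F L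
  have hp : algebraMap A L π₁ ≠ 0 := by simpa using hπ₁.ne_zero
  have hq : algebraMap A L π₂ ≠ 0 := by simpa using hπ₂.ne_zero
  set x := algebraMap A L π₁ ^ a * algebraMap A L π₂ ^ b with hx
  have hx0 : x ≠ 0 := mul_ne_zero (zpow_ne_zero _ hp) (zpow_ne_zero _ hq)
  have hxi : algebraMap A L π₁ ^ (-a) * algebraMap A L π₂ ^ (-b) = x⁻¹ := by
    rw [zpow_neg, zpow_neg, hx, mul_inv]
  unfold HasExponents
  rw [hxi] at hz ⊢
  have hzt : IsIntegral A (z * t) := by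
    have h1 := mul_mem_powLattice hz ht
    rwa [inv_mul_cancel₀ hx0, mem_powLattice_one] at h1
  have hu : IsIntegralUnit A (z * t) := isIntegralUnit_coe_iff.mpr
    (isUnit_of_isUnit_trace (F := F) (b := ⟨z * t, hzt⟩) hs hst)
  have hz0 : z ≠ 0 := left_ne_zero_of_mul hu.1
  have ht0 : t ≠ 0 := right_ne_zero_of_mul hu.1
  refine ⟨mul_ne_zero (pow_ne_zero _ hz0) (inv_ne_zero hx0), hz, ?_⟩
  have h2 : (z ^ n * x⁻¹)⁻¹ = t ^ n * x * ((z * t) ^ n)⁻¹ := by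
    clear_value x
    rw [mul_pow]
    field_simp
  rw [h2]
  exact (mem_powLattice.mp ht).mul (hu.pow n).2.2

end Kummer

theorem mainTheorem10
    {A F L : Type*} [CommRing A] [IsRegularLocalRing A]
    [IsAdicComplete (IsLocalRing.maximalIdeal A) A] (hdim : ringKrullDim A = 2)
    [Field F] [Algebra A F] [IsFractionRing A F]
    [Field L] [Algebra F L] [Algebra A L] [IsScalarTower A F L]
    [FiniteDimensional F L] [IsGalois F L]
    (hdeg : (Module.finrank F L : IsLocalRing.ResidueField A) ≠ 0)
    (π₁ π₂ : A) (hmax : IsLocalRing.maximalIdeal A = Ideal.span {π₁, π₂})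
    (hram : UnramifiedExceptAt A L {π₁, π₂}) :
    ∃ L₁ L₂ : IntermediateField F L, L₁ ≤ L₂ ∧
      UnramifiedOn A L₁ ∧
      ∃ (d₁ : ℕ) (u : (integralClosure A L₁)ˣ) (α : L), 0 < d₁ ∧
        α ^ d₁ = ((u : integralClosure A L₁) : L₁) * algebraMap A L π₁ ∧
        L₂ = (IntermediateField.adjoin L₁ {α}).restrictScalars F ∧
        ∃ (d₂ i : ℕ) (v : (integralClosure A L₂)ˣ) (β : L), 0 < d₂ ∧
          β ^ d₂ = ((v : integralClosure A L₂) : L₂) * α ^ i * algebraMap A L π₂ ∧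
          IntermediateField.adjoin L₂ {β} = ⊤ := by
  have : IsDomain A := (IsFractionRing.injective A F).isDomain
  have hmax' : IsLocalRing.maximalIdeal A = Ideal.span {π₂, π₁} := by rw [hmax, Set.pair_comm]
  have : UniqueFactorizationMonoid A := uniqueFactorizationMonoid_of_ringKrullDim_eq_two hdim hmax
  have hπ₁ : Prime π₁ := prime_of_maximalIdeal_eq_span hdim hmax
  have hπ₂ : Prime π₂ := prime_of_maximalIdeal_eq_span hdim hmax'
  have h12 : ¬ π₁ ∣ π₂ := fun h ↦ pow_notMem_span_of_ringKrullDim_eq_two hdim hmax 1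
    (by rwa [pow_one, Ideal.mem_span_singleton])
  have : IsPrincipalIdealRing (A ⧸ Ideal.span {π₁}) :=
    (isDomain_and_isPrincipalIdealRing_quotient hdim hmax).2
  have hn : IsUnit (Module.finrank F L : A) := by
    by_contra h
    refine hdeg ?_
    rw [← map_natCast (IsLocalRing.residue A), IsLocalRing.residue_eq_zero_iff]
    exact h
  have hn0 : NeZero (Module.finrank F L) := ⟨Module.finrank_pos.ne'⟩
  have : FaithfulSMul A L := faithfulSMul_of_isScalarTower A F L
  have hfin : Module.Finite A (integralClosure A L) :=
    IsIntegralClosure.finite A F L (integralClosure A L)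
  let I := (IsLocalRing.maximalIdeal A).map (algebraMap A (integralClosure A L))
  have : IsAdicComplete (IsLocalRing.maximalIdeal A) (integralClosure A L) :=
    isAdicComplete_of_finite_of_isLocalRing
  have : IsAdicComplete I (integralClosure A L) := (IsAdicComplete.map_algebraMap_iff _ _).mpr this
  have : HenselianRing (integralClosure A L) I := inferInstance
  have : IsArtinianRing (integralClosure A L ⧸ I) := isArtinianRing_quotient_map_maximalIdeal
  have : IsLocalRing (integralClosure A L) := isLocalRing_of_henselianRing_of_isArtinianRing I
  have hpure := fun (a b : ℤ) (z : L) ↦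
    mem_sup_or_hasExponents (z := z) hn hmax hπ₁ hπ₂ h12 hram a b
  have hp : algebraMap A L π₁ ≠ 0 := by simpa using hπ₁.ne_zero
  have hq : algebraMap A L π₂ ≠ 0 := by simpa using hπ₂.ne_zero
  obtain ⟨θ, hθ, hconj, hres⟩ := exists_generator_inertia_field (A := A) (F := F) (L := L) hn
  set n := Module.finrank F L
  set p := algebraMap A L π₁
  set q := algebraMap A L π₂
  obtain ⟨a₁, b₂, c, d₁, d₂, i, hd₁, hd₂, had, hbd, hci, h1, h2, hΛ⟩ :=
    exists_triangular_basis (exponentGroup A n hp hq) (NeZero.ne n)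
      (mem_exponentGroup.mpr ⟨p, HasExponents.left hp⟩)
      (mem_exponentGroup.mpr ⟨q, HasExponents.right hq⟩)
  obtain ⟨α₀, hα₀⟩ := mem_exponentGroup.mp h1
  obtain ⟨β₀, hβ₀⟩ := mem_exponentGroup.mp h2
  let L₁ := IntermediateField.adjoin F {θ}
  -- Dividing `α₀` and `β₀` by suitable units moves the constants of their equations into `L₁`.
  have hα₀d : IsIntegralUnit A (α₀ ^ d₁ / p) := by
    refine (hα₀.pow d₁).isIntegralUnit_div (NeZero.ne n) hp hq ?_
    rw [zero_mul, ← Nat.cast_mul, had]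
    exact HasExponents.left hp
  obtain ⟨u, huL₁, η, hu, hη, huη⟩ := hα₀d.exists_eq_mul_pow I L₁ hres
    (isUnit_natCast_of_dvd (had ▸ Dvd.intro_left a₁ rfl) hn)
  let α := α₀ / η
  have hα : HasExponents A n p q α a₁ 0 := by
    have h3 := hα₀.mul hp hq (HasExponents.of_isIntegralUnit hη.inv)
    rwa [add_zero, add_zero, ← div_eq_mul_inv] at h3
  have hαd : α ^ d₁ = u * p := by
    rw [div_pow, div_eq_iff (pow_ne_zero _ hη.1), mul_right_comm, ← huη, div_mul_cancel₀ _ hp]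
  have hβ₀d : IsIntegralUnit A (β₀ ^ d₂ / (α ^ i * q)) := by
    have hbd' : ((b₂ * d₂ : ℕ) : ℤ) = n := congrArg _ hbd
    refine (hβ₀.pow d₂).isIntegralUnit_div (NeZero.ne n) hp hq ?_
    have h3 := (hα.pow i).mul hp hq (HasExponents.right (A := A) (n := n) (p := p) hq)
    rwa [zero_mul, zero_add, add_zero, ← Nat.cast_mul, ← hci, ← hbd', Nat.cast_mul,
      Nat.cast_mul] at h3
  obtain ⟨v, hvL₁, η', hv, hη', hvη⟩ := hβ₀d.exists_eq_mul_pow I L₁ hres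
    (isUnit_natCast_of_dvd (hbd ▸ Dvd.intro_left b₂ rfl) hn)
  let β := β₀ / η'
  have hβ : HasExponents A n p q β c b₂ := by
    have h3 := hβ₀.mul hp hq (HasExponents.of_isIntegralUnit hη'.inv)
    rwa [add_zero, add_zero, ← div_eq_mul_inv] at h3
  have hα0 : α ≠ 0 := hα.ne_zero (NeZero.ne n)
  have hβd : β ^ d₂ = v * α ^ i * q := by
    rw [div_pow, div_eq_iff (pow_ne_zero _ hη'.1), mul_assoc v, mul_right_comm, ← hvη,
      div_mul_cancel₀ _ (mul_ne_zero (pow_ne_zero _ hα0) hq)]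
  let L₂ := (IntermediateField.adjoin L₁ {α}).restrictScalars F
  have hL₁₂ : L₁ ≤ L₂ := fun x hx ↦
    (IntermediateField.adjoin L₁ {α}).algebraMap_mem (⟨x, hx⟩ : L₁)
  obtain ⟨u', hu'⟩ := exists_unit_coe_eq_of_isIntegralUnit L₁ huL₁ hu
  obtain ⟨v', hv'⟩ := exists_unit_coe_eq_of_isIntegralUnit L₂ (hL₁₂ hvL₁) hv
  refine ⟨L₁, L₂, hL₁₂, unramifiedOn_adjoin_of_forall_isIntegralUnit_sub hθ hconj, d₁, u', α, hd₁,
    by rw [hu', hαd], rfl, d₂, i, v', β, hd₂, by rw [hv', hβd], ?_⟩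
  rw [← IntermediateField.restrictScalars_eq_top_iff (K := F)]
  set M := (IntermediateField.adjoin L₂ {β}).restrictScalars F with hM
  have hL₂M : L₂ ≤ M := fun x hx ↦
    (IntermediateField.adjoin L₂ {β}).algebraMap_mem (⟨x, hx⟩ : L₂)
  have hαM : α ∈ M := hL₂M (IntermediateField.mem_adjoin_simple_self L₁ α)
  have hβM : β ∈ M := IntermediateField.mem_adjoin_simple_self L₂ β
  refine eq_top_of_forall_hasExponents (hmax ▸ Ideal.subset_span (by simp))
    (hmax ▸ Ideal.subset_span (by simp)) hp hq hpure M
    (fun b ↦ (hres b).imp fun c hc ↦ ⟨hL₂M (hL₁₂ hc.1), hc.2⟩) fun a b z hz ↦ ?_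
  obtain ⟨k, l, rfl, rfl⟩ := hΛ a b (mem_exponentGroup.mpr ⟨z, hz⟩)
  refine ⟨α ^ k * β ^ l, M.mul_mem (zpow_mem hαM k) (zpow_mem hβM l), ?_⟩
  have h3 := (hα.zpow k).mul hp hq (hβ.zpow l)
  rwa [zero_mul, zero_add] at h3
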